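/- Let $n\ge 1$ and $m\ge 0$ be integers and let $\nu>0$ be real. Write $|z|^2=\sum_{i}|z_i|^2$ for $z\in\mathbb C^n$, let $\lambda$ be Lebesgue measure on $\mathbb C^n$, and for a multi-index $p\in\mathbb Z_{\ge 0}^n$ put $|p|=\sum_i p_i$, $p!=\prod_i p_i!$ and $D^p=\partial^{|p|}/\partial z_1^{p_1}\cdots\partial z_n^{p_n}$. For a function $f$ holomorphic near $0$ with Taylor expansion $f(z)=\sum_p a_p z^p$ put $f_{1,m}(z)=\sum_{|p|<m}a_pz^p$. For $R>0$ and $\alpha>-1$ let $\mathcal A^{2,\alpha}_{m}(\mathbb B^n_R)$ (the weighted Bergman–Dirichlet space of order $m$) be the space of holomorphic functions $f$ on the ball $\mathbb B^n_R=\{z\in\mathbb C^n: |z|<R\}$ with $$\|f_{1,m}\|_{\alpha,R}^2+\sum_{|p|=m}\frac{m!}{p!}\,\|D^pf\|_{\alpha,R}^2<\infty,\qquad \|g\|_{\alpha,R}^2=\int_{\mathbb B^n_R}|g(z)|^2\Bigl(1-\frac{|z|^2}{R^2}\Bigr)^{\alpha}d\lambda(z),$$ with the inner product associated to this norm, and let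 $\mathcal B^{2,\nu}_{m}(\mathbb C^n)$ (the weighted Bargmann–Dirichlet space of order $m$) be the space of entire functions $f$ on $\mathbb C^n$ with $$\|f_{1,m}\|_{\nu}^2+\sum_{|p|=m}\frac{m!}{p!}\,\|D^pf\|_{\nu}^2<\infty,\qquad \|g\|_{\nu}^2=\int_{\mathbb C^n}|g(z)|^2e^{-\nu|z|^2}d\lambda(z),$$ with the inner product associated to this norm. A reproducing kernel of such a space of functions on $\Omega$ is a function $K$ on $\Omega\times\Omega$ such that, for every $w\in\Omega$, $K(\cdot,w)$ lies in the space and $f(w)=\langle f,K(\cdot,w)\rangle$ for all $f$ in the space. Then, for every $R>0$, the space $\mathcal A^{2,\nu R^2}_{m}(\mathbb B^n_R)$ has a reproducing kernel $K_R$, the space $\mathcal B^{2,\nu}_{m}(\mathbb C^n)$ has a reproducing kernel $K_\infty$, and, as $R\to\infty$, $K_R(z,w)\to K_\infty(z,w)$ for all $z,w\in\mathbb C^n$ and uniformly for $(z,w)$ in any compact subset of $\mathbb C^n\times\mathbb C^n$ (for given $(z,w)$, respectively a given compact set, $K_R$ is defined there for all sufficiently large $R$). -/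

import Mathlib

open MeasureTheory Filter Topology
open scoped ENNReal ComplexConjugate

/-! Points of `ℂⁿ` are functions `Fin n → ℂ`, so that `volume` is the Lebesgue measure of `ℂⁿ`
(the product of the Lebesgue measures `dx dy` of the factors).  The type carries the right topology,
but not the Hermitian norm as its norm; the Hermitian norm is therefore written out. -/

namespace BergmanDirichlet

noncomputable section

/-- The squared Hermitian norm `|z|² = |z₁|² + ⋯ + |zₙ|²`. -/
def hnormSq {n : ℕ} (z : Fin n → ℂ) : ℝ := ∑ i, ‖z i‖ ^ 2

/-- The open Hermitian ball of radius `R` in `ℂⁿ` centred at `0`. -/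
def hball (n : ℕ) (R : ℝ) : Set (Fin n → ℂ) := {z | Real.sqrt (hnormSq z) < R}

/-- The complex partial derivative `∂f/∂z_i`. -/
def pderiv {n : ℕ} (i : Fin n) (f : (Fin n → ℂ) → ℂ) : (Fin n → ℂ) → ℂ :=
  fun z => fderiv ℂ f z (Pi.single i 1)

/-- `D^p f = ∂^{|p|} f / ∂z₁^{p₁} ⋯ ∂zₙ^{pₙ}` for a multi-index `p`. -/
def multiDeriv {n : ℕ} (p : Fin n → ℕ) (f : (Fin n → ℂ) → ℂ) : (Fin n → ℂ) → ℂ :=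
  (List.finRange n).foldr (fun i g => (pderiv i)^[p i] g) f

/-- The Taylor coefficient `a_p = D^p f(0) / p!` of `f` at the origin. -/
def taylorCoeff {n : ℕ} (f : (Fin n → ℂ) → ℂ) (p : Fin n → ℕ) : ℂ :=
  multiDeriv p f 0 / ((∏ i, (p i).factorial : ℕ) : ℂ)

/-- The low-order part `f_{1,m}(z) = ∑_{|p| < m} a_p z^p` of `f`.  The finset
`Finset.piAntidiag Finset.univ k` consists of the multi-indices `p` with `|p| = k`. -/
def lowPart {n : ℕ} (m : ℕ) (f : (Fin n → ℂ) → ℂ) : (Fin n → ℂ) → ℂ :=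
  fun z => ∑ k ∈ Finset.range m, ∑ p ∈ Finset.piAntidiag (Finset.univ : Finset (Fin n)) k,
    taylorCoeff f p * ∏ i, z i ^ p i

/-- The squared norm `‖f_{1,m}‖² + ∑_{|p| = m} (m! / p!) ‖D^p f‖²`, with the norms on the right
being those of `L²(μ)`; it may be infinite.  For `|p| = m` the number
`Nat.multinomial Finset.univ p` is `m! / p!`. -/
def normSq {n : ℕ} (μ : Measure (Fin n → ℂ)) (m : ℕ) (f : (Fin n → ℂ) → ℂ) : ℝ≥0∞ :=
  ∫⁻ z, ‖lowPart m f z‖ₑ ^ 2 ∂μ +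
    ∑ p ∈ Finset.piAntidiag (Finset.univ : Finset (Fin n)) m,
      (Nat.multinomial Finset.univ p : ℝ≥0∞) * ∫⁻ z, ‖multiDeriv p f z‖ₑ ^ 2 ∂μ

/-- The inner product
`⟨f, g⟩ = ⟨f_{1,m}, g_{1,m}⟩ + ∑_{|p| = m} (m! / p!) ⟨D^p f, D^p g⟩`, with the inner products on
the right being those of `L²(μ)`, linear in the first argument. -/
def innerProd {n : ℕ} (μ : Measure (Fin n → ℂ)) (m : ℕ) (f g : (Fin n → ℂ) → ℂ) : ℂ :=
  ∫ z, lowPart m f z * conj (lowPart m g z) ∂μ +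
    ∑ p ∈ Finset.piAntidiag (Finset.univ : Finset (Fin n)) m,
      (Nat.multinomial Finset.univ p : ℂ) * ∫ z, multiDeriv p f z * conj (multiDeriv p g z) ∂μ

/-- The space of the holomorphic functions on the open set `Ω` that have a finite norm of order `m`
with respect to `μ`, a measure concentrated on `Ω`.  The values of `f` off `Ω` play no role. -/
def space {n : ℕ} (Ω : Set (Fin n → ℂ)) (μ : Measure (Fin n → ℂ)) (m : ℕ) :
    Set ((Fin n → ℂ) → ℂ) :=
  {f | AnalyticOnNhd ℂ f Ω ∧ normSq μ m f < ∞}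

/-- `K` is a reproducing kernel on `Ω` of `space Ω μ m`: for `w ∈ Ω` the function `K(·, w)` belongs
to the space, and `f(w) = ⟨f, K(·, w)⟩` for every `f` in the space. -/
structure IsReproducingKernel {n : ℕ} (Ω : Set (Fin n → ℂ)) (μ : Measure (Fin n → ℂ)) (m : ℕ)
    (K : (Fin n → ℂ) → (Fin n → ℂ) → ℂ) : Prop where
  mem_space : ∀ w ∈ Ω, (fun z => K z w) ∈ space Ω μ m
  reproducing : ∀ f ∈ space Ω μ m, ∀ w ∈ Ω, f w = innerProd μ m f (fun z => K z w)

/-- The measure `(1 - |z/R|²)^α dλ(z)` on the ball of radius `R`. -/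
def ballMeasure (n : ℕ) (R α : ℝ) : Measure (Fin n → ℂ) :=
  (volume.restrict (hball n R)).withDensity
    (fun z => ENNReal.ofReal ((1 - hnormSq z / R ^ 2) ^ α))

/-- The measure `e^{-ν|z|²} dλ(z)` on `ℂⁿ`. -/
def gaussMeasure (n : ℕ) (ν : ℝ) : Measure (Fin n → ℂ) :=
  volume.withDensity (fun z => ENNReal.ofReal (Real.exp (-ν * hnormSq z)))

/-- `K` is the reproducing kernel of the weighted Bergman–Dirichlet space of order `m` on the ball
of radius `R`, with weight `(1 - |z/R|²)^α`. -/
def IsBergmanDirichletKernel (n : ℕ) (R α : ℝ) (m : ℕ)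
    (K : (Fin n → ℂ) → (Fin n → ℂ) → ℂ) : Prop :=
  IsReproducingKernel (hball n R) (ballMeasure n R α) m K

/-- `K` is the reproducing kernel of the weighted Bargmann–Dirichlet space of order `m` on `ℂⁿ`,
with weight `e^{-ν|z|²}`. -/
def IsBargmannDirichletKernel (n : ℕ) (ν : ℝ) (m : ℕ)
    (K : (Fin n → ℂ) → (Fin n → ℂ) → ℂ) : Prop :=
  IsReproducingKernel Set.univ (gaussMeasure n ν) m K

end

end BergmanDirichlet

open MeasureTheory Filter Topology
open scoped ENNReal ComplexConjugate

namespace BergmanDirichlet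

noncomputable section

variable {n : ℕ}

/-! ### Partial derivatives of holomorphic functions -/

/-! Both weights have a density `W(|z|²)`, and for such a measure `μ` the kernel can be written
down. Invariance under the torus makes monomials orthogonal, and among multi-indices of one degree
`∫ |z^p|² dμ` is proportional to `p!`. With `M_k = ∫ |z_i|^{2k} dμ` it follows that pairing a
square-integrable holomorphic `g` with `⟨z, w⟩^k` returns `M_k g_k(w)`, where `g_k` is the
homogeneous part of degree `k` (`integral_mul_conj_hin_pow`).

This suggests the kernel `∑_{k<m} x^k / M_k + ∑_{k≥m} x^k / ((k)_m² M_{k-m})` at `x = ⟨z, w⟩`, with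
`(k)_m = k(k-1)⋯(k-m+1)`. One factor `(k)_m` is absorbed by differentiating the kernel `m` times,
the other by the identity `∑_{|q|=m} (m!/q!) w^q (D^q f)_j(w) = (j+m)_m f_{j+m}(w)`
(`sum_homPart_multiDeriv`). The low-order term of the inner product then yields `f_k(w)` for `k <
m`, the derivative terms yield the remaining `f_k(w)`, and on a balanced domain these add up to
`f(w)` (`hasSum_homPart`, `isReproducingKernel`). Kernels are unique on `Ω × Ω` (`eq_kernel`), so
only these explicit ones have to be compared.

Convergence is then a statement about power series in one variable. By Bernoulli's inequality `(1 -
s/R²)^{νR²}` increases with `R`, and its limit is `e^{-νs}`; so the moments increase to the Gaussian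
ones and the kernel coefficients decrease to theirs. The coefficients at a single radius `R₀`
dominate all later ones. If `R₀²` exceeds a bound `B` for `|⟨z, w⟩|` on the compact set, the
dominating series converges at `B`, and dominated convergence of series gives the uniform limit
(`tendstoUniformlyOn_powSeries`). -/

theorem pderiv_eqOn {Ω : Set (Fin n → ℂ)} (hΩ : IsOpen Ω) {f g : (Fin n → ℂ) → ℂ}
    (h : Set.EqOn f g Ω) (i : Fin n) : Set.EqOn (pderiv i f) (pderiv i g) Ω := fun z hz => by
  have : f =ᶠ[𝓝 z] g := h.eventuallyEq_of_mem (hΩ.mem_nhds hz)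
  simp only [pderiv, this.fderiv_eq]

theorem analyticOnNhd_pderiv {Ω : Set (Fin n → ℂ)} {f : (Fin n → ℂ) → ℂ}
    (hf : AnalyticOnNhd ℂ f Ω) (i : Fin n) : AnalyticOnNhd ℂ (pderiv i f) Ω := fun z hz =>
  ((ContinuousLinearMap.apply ℂ ℂ (Pi.single i (1 : ℂ) : Fin n → ℂ)).analyticAt _).comp
    (hf.fderiv z hz)

theorem iterate_pderiv_eqOn {Ω : Set (Fin n → ℂ)} (hΩ : IsOpen Ω) {f g : (Fin n → ℂ) → ℂ}
    (h : Set.EqOn f g Ω) (i : Fin n) (k : ℕ) :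
    Set.EqOn ((pderiv i)^[k] f) ((pderiv i)^[k] g) Ω := by
  induction k with
  | zero => simpa using h
  | succ k ih => simpa only [Function.iterate_succ_apply'] using pderiv_eqOn hΩ ih i

theorem multiDeriv_eqOn {Ω : Set (Fin n → ℂ)} (hΩ : IsOpen Ω) {f g : (Fin n → ℂ) → ℂ}
    (h : Set.EqOn f g Ω) (p : Fin n → ℕ) : Set.EqOn (multiDeriv p f) (multiDeriv p g) Ω := by
  unfold multiDeriv
  induction List.finRange n with
  | nil => simpa using h
  | cons i l ih => simpa using iterate_pderiv_eqOn hΩ ih i (p i)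

theorem analyticOnNhd_multiDeriv {Ω : Set (Fin n → ℂ)} {f : (Fin n → ℂ) → ℂ}
    (hf : AnalyticOnNhd ℂ f Ω) (p : Fin n → ℕ) : AnalyticOnNhd ℂ (multiDeriv p f) Ω := by
  unfold multiDeriv
  induction List.finRange n with
  | nil => simpa using hf
  | cons i l ih =>
    simp only [List.foldr_cons]
    induction p i with
    | zero => simpa using ih
    | succ k ih' => simpa only [Function.iterate_succ_apply'] using analyticOnNhd_pderiv ih' i

theorem pderiv_comm {f : (Fin n → ℂ) → ℂ} {z : Fin n → ℂ} (hf : AnalyticAt ℂ f z) (i j : Fin n) :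
    pderiv i (pderiv j f) z = pderiv j (pderiv i f) z := by
  have hd : DifferentiableAt ℂ (fderiv ℂ f) z := hf.fderiv.differentiableAt
  have hs : IsSymmSndFDerivAt ℂ f z := hf.contDiffAt.isSymmSndFDerivAt_of_omega
  have key : ∀ i j : Fin n, pderiv i (pderiv j f) z =
      fderiv ℂ (fderiv ℂ f) z (Pi.single i 1) (Pi.single j 1) := fun i j => by
    unfold pderiv
    rw [fderiv_clm_apply hd (differentiableAt_const _)]
    simp
  rw [key, key, hs]

/-- The holomorphic functions on `Ω`, extended by zero. -/
def holoOn (Ω : Set (Fin n → ℂ)) : Submodule ℂ ((Fin n → ℂ) → ℂ) where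
  carrier := {f | AnalyticOnNhd ℂ f Ω ∧ ∀ z ∉ Ω, f z = 0}
  add_mem' := fun {f g} hf hg => ⟨hf.1.add hg.1, fun z hz => by simp [hf.2 z hz, hg.2 z hz]⟩
  zero_mem' := ⟨analyticOnNhd_const, fun _ _ => rfl⟩
  smul_mem' := fun c f hf => ⟨fun z hz => analyticAt_const.smul (hf.1 z hz),
    fun z hz => by simp [hf.2 z hz]⟩

theorem indicator_mem_holoOn {Ω : Set (Fin n → ℂ)} (hΩ : IsOpen Ω) {f : (Fin n → ℂ) → ℂ}
    (hf : AnalyticOnNhd ℂ f Ω) : Ω.indicator f ∈ holoOn Ω :=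
  ⟨AnalyticOnNhd.congr hΩ hf (Set.eqOn_indicator.symm),
    fun _ hz => Set.indicator_of_notMem hz f⟩

/-- The partial derivative `∂/∂z_i` as an endomorphism of the holomorphic functions on `Ω`. -/
def partialEnd {Ω : Set (Fin n → ℂ)} (hΩ : IsOpen Ω) (i : Fin n) : Module.End ℂ (holoOn Ω) where
  toFun f := ⟨Ω.indicator (pderiv i f), indicator_mem_holoOn hΩ (analyticOnNhd_pderiv f.2.1 i)⟩
  map_add' f g := by
    ext z
    by_cases hz : z ∈ Ω
    · simp [hz, pderiv, fderiv_add (f.2.1 z hz).differentiableAt (g.2.1 z hz).differentiableAt]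
    · simp [hz]
  map_smul' c f := by
    ext z
    by_cases hz : z ∈ Ω
    · simp [hz, pderiv, fderiv_const_smul (f.2.1 z hz).differentiableAt]
    · simp [hz]

theorem partialEnd_apply {Ω : Set (Fin n → ℂ)} (hΩ : IsOpen Ω) (i : Fin n) (f : holoOn Ω) :
    Set.EqOn (partialEnd hΩ i f : (Fin n → ℂ) → ℂ) (pderiv i f) Ω :=
  Set.eqOn_indicator

theorem partialEnd_commute {Ω : Set (Fin n → ℂ)} (hΩ : IsOpen Ω) (i j : Fin n) :
    Commute (partialEnd hΩ i) (partialEnd hΩ j) := by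
  ext f z
  have key : ∀ i j : Fin n, ∀ z ∈ Ω, (partialEnd hΩ i (partialEnd hΩ j f)).1 z =
      pderiv i (pderiv j f) z := fun i j z hz =>
    (partialEnd_apply hΩ i _ hz).trans (pderiv_eqOn hΩ (partialEnd_apply hΩ j f) i hz)
  by_cases hz : z ∈ Ω
  · exact (key i j z hz).trans ((pderiv_comm (f.2.1 z hz) i j).trans (key j i z hz).symm)
  · exact ((partialEnd hΩ i (partialEnd hΩ j f)).2.2 z hz).trans
      ((partialEnd hΩ j (partialEnd hΩ i f)).2.2 z hz).symm

theorem partialEnd_pow_apply {Ω : Set (Fin n → ℂ)} (hΩ : IsOpen Ω) (i : Fin n) (k : ℕ)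
    (f : holoOn Ω) :
    Set.EqOn ((partialEnd hΩ i ^ k) f : (Fin n → ℂ) → ℂ) ((pderiv i)^[k] f) Ω := by
  induction k with
  | zero => intro z _; simp
  | succ k ih =>
    intro z hz
    rw [pow_succ', Module.End.mul_apply, partialEnd_apply hΩ i _ hz, Function.iterate_succ_apply']
    exact pderiv_eqOn hΩ ih i hz

theorem prod_partialEnd_apply {Ω : Set (Fin n → ℂ)} (hΩ : IsOpen Ω) (p : Fin n → ℕ)
    (f : holoOn Ω) :
    Set.EqOn (((List.finRange n).map fun i => partialEnd hΩ i ^ p i).prod f : (Fin n → ℂ) → ℂ)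
      (multiDeriv p f) Ω := by
  unfold multiDeriv
  induction List.finRange n with
  | nil => intro z _; simp
  | cons i l ih =>
    intro z hz
    rw [List.map_cons, List.prod_cons, Module.End.mul_apply, partialEnd_pow_apply hΩ i _ _ hz]
    exact iterate_pderiv_eqOn hΩ ih i (p i) hz

/-! ### Derivatives along complex lines through the origin -/

/-- The directional derivative along `w`. -/
def dirEnd {Ω : Set (Fin n → ℂ)} (hΩ : IsOpen Ω) (w : Fin n → ℂ) : Module.End ℂ (holoOn Ω) :=
  ∑ i, w i • partialEnd hΩ i

theorem holoOn_sum_apply {Ω : Set (Fin n → ℂ)} {ι : Type*} (s : Finset ι) (f : ι → holoOn Ω)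
    (z : Fin n → ℂ) : (∑ i ∈ s, f i : holoOn Ω).1 z = ∑ i ∈ s, (f i).1 z := by
  simp

/-- The partial derivatives commute on holomorphic functions, so this is the multinomial theorem.
Extension by zero turns the functions holomorphic on `Ω` into a module on which the derivatives are
honest endomorphisms, as that theorem requires. -/
theorem dirEnd_pow_apply {Ω : Set (Fin n → ℂ)} (hΩ : IsOpen Ω) (w : Fin n → ℂ) (k : ℕ)
    (f : holoOn Ω) {z : Fin n → ℂ} (hz : z ∈ Ω) :
    ((dirEnd hΩ w ^ k) f).1 z = ∑ q ∈ Finset.piAntidiag (Finset.univ : Finset (Fin n)) k,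
      (Nat.multinomial Finset.univ q : ℂ) * (∏ i, w i ^ q i) * multiDeriv q f z := by
  have hc : ((Finset.univ : Finset (Fin n)) : Set (Fin n)).Pairwise
      (Function.onFun Commute fun i => w i • partialEnd hΩ i) := fun i _ j _ _ =>
    ((partialEnd_commute hΩ i j).smul_left _).smul_right _
  unfold dirEnd
  rw [Finset.sum_pow_eq_sum_piAntidiag_of_commute _ _ hc, LinearMap.sum_apply, holoOn_sum_apply]
  refine Finset.sum_congr rfl fun q _ => ?_
  have h2 : (Finset.univ.noncommProd (fun i => (w i • partialEnd hΩ i) ^ q i)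
      (fun i hi j hj hij => (hc hi hj hij).pow_pow _ _)) =
      (∏ i, w i ^ q i) • ((List.finRange n).map fun i => partialEnd hΩ i ^ q i).prod := by
    -- Scalars are extracted from products over lists, since the list order is the order in which
    -- `multiDeriv` composes the derivatives.
    have : ∀ l : List (Fin n), (l.map fun i => (w i • partialEnd hΩ i) ^ q i).prod =
        (l.map fun i => w i ^ q i).prod • (l.map fun i => partialEnd hΩ i ^ q i).prod := by
      intro l
      induction l with
      | nil => simp
      | cons i l ih =>
        rw [List.map_cons, List.prod_cons, ih, List.map_cons, List.prod_cons, List.map_cons,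
          List.prod_cons, smul_pow, smul_mul_smul_comm]
    have h3 := Finset.noncommProd_toFinset (List.finRange n)
      (fun i => (w i • partialEnd hΩ i) ^ q i)
      (fun i hi j hj hij => (hc (by simp) (by simp) hij).pow_pow _ _) (List.nodup_finRange n)
    simp only [List.toFinset_finRange] at h3
    rw [h3, this, ← List.ofFn_eq_map, List.prod_ofFn]
  rw [h2]
  rw [mul_assoc, ← prod_partialEnd_apply hΩ q f hz, ← nsmul_eq_mul]
  simp
  ring

theorem hasDerivAt_line {Ω : Set (Fin n → ℂ)} (hΩ : IsOpen Ω) (f : holoOn Ω) (w : Fin n → ℂ)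
    {t : ℂ} (ht : t • w ∈ Ω) :
    HasDerivAt (fun t : ℂ => f.1 (t • w)) ((dirEnd hΩ w f).1 (t • w)) t := by
  have h1 : HasDerivAt (fun t : ℂ => t • w) w t := by
    simpa using (hasDerivAt_id t).smul_const w
  have h2 := (f.2.1 _ ht).differentiableAt.hasFDerivAt.comp_hasDerivAt t h1
  convert! h2 using 1
  rw [dirEnd, LinearMap.sum_apply, holoOn_sum_apply]
  have h3 := LinearMap.pi_apply_eq_sum_univ (fderiv ℂ f.1 (t • w)).toLinearMap w
  simp only [ContinuousLinearMap.coe_coe] at h3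
  rw [h3]
  refine Finset.sum_congr rfl fun i _ => ?_
  have h4 := partialEnd_apply hΩ i f ht
  have h5 : (Pi.single i 1 : Fin n → ℂ) = fun j => if i = j then 1 else 0 := by
    ext j; simp [Pi.single_apply, eq_comm]
  rw [pderiv, h5] at h4
  simp [h4]

theorem continuous_line (w : Fin n → ℂ) : Continuous fun t : ℂ => t • w := by fun_prop

theorem iteratedDeriv_line_holoOn {Ω : Set (Fin n → ℂ)} (hΩ : IsOpen Ω) (f : holoOn Ω)
    (w : Fin n → ℂ) (k : ℕ) {t : ℂ} (ht : t • w ∈ Ω) :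
    iteratedDeriv k (fun t : ℂ => f.1 (t • w)) t = ((dirEnd hΩ w ^ k) f).1 (t • w) := by
  induction k generalizing t with
  | zero => simp
  | succ k ih =>
    have h : iteratedDeriv k (fun t : ℂ => f.1 (t • w)) =ᶠ[𝓝 t]
        fun t => ((dirEnd hΩ w ^ k) f).1 (t • w) := by
      filter_upwards [(continuous_line w).continuousAt.preimage_mem_nhds (hΩ.mem_nhds ht)] with s hs
        using ih hs
    rw [iteratedDeriv_succ, h.deriv_eq, (hasDerivAt_line hΩ _ w ht).deriv, pow_succ',
      Module.End.mul_apply]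

theorem iteratedDeriv_line {Ω : Set (Fin n → ℂ)} (hΩ : IsOpen Ω) {f : (Fin n → ℂ) → ℂ}
    (hf : AnalyticOnNhd ℂ f Ω) (w : Fin n → ℂ) (k : ℕ) {t : ℂ} (ht : t • w ∈ Ω) :
    iteratedDeriv k (fun t : ℂ => f (t • w)) t =
      ∑ q ∈ Finset.piAntidiag (Finset.univ : Finset (Fin n)) k,
      (Nat.multinomial Finset.univ q : ℂ) * (∏ i, w i ^ q i) * multiDeriv q f (t • w) := by
  have h : (fun t : ℂ => f (t • w)) =ᶠ[𝓝 t] fun t => Ω.indicator f (t • w) := by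
    filter_upwards [(continuous_line w).continuousAt.preimage_mem_nhds (hΩ.mem_nhds ht)] with s hs
    exact (Set.indicator_of_mem (s := Ω) hs f).symm
  rw [h.iteratedDeriv_eq]
  refine (iteratedDeriv_line_holoOn hΩ ⟨_, indicator_mem_holoOn hΩ hf⟩ w k ht).trans ?_
  rw [dirEnd_pow_apply hΩ w k _ ht]
  refine Finset.sum_congr rfl fun q _ => ?_
  rw [multiDeriv_eqOn hΩ (Set.eqOn_indicator : Set.EqOn (Ω.indicator f) f Ω) q ht]

/-! ### Homogeneous parts -/

/-- The homogeneous part of degree `k` of the Taylor expansion of `f` at the origin. -/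
def homPart (k : ℕ) (f : (Fin n → ℂ) → ℂ) (w : Fin n → ℂ) : ℂ :=
  iteratedDeriv k (fun t : ℂ => f (t • w)) 0 / k.factorial

theorem homPart_eq_sum {Ω : Set (Fin n → ℂ)} (hΩ : IsOpen Ω) (h0 : 0 ∈ Ω)
    {f : (Fin n → ℂ) → ℂ} (hf : AnalyticOnNhd ℂ f Ω) (k : ℕ) (w : Fin n → ℂ) :
    homPart k f w = ∑ q ∈ Finset.piAntidiag (Finset.univ : Finset (Fin n)) k,
      taylorCoeff f q * ∏ i, w i ^ q i := by
  rw [homPart, iteratedDeriv_line hΩ hf w k (by simpa using h0), Finset.sum_div]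
  refine Finset.sum_congr rfl fun q hq => ?_
  have hq' : ∑ i, q i = k := (Finset.mem_piAntidiag.mp hq).1
  have h1 := Nat.multinomial_spec Finset.univ q
  rw [hq'] at h1
  have h2 : ((∏ i, (q i).factorial : ℕ) : ℂ) ≠ 0 :=
    Nat.cast_ne_zero.mpr (Finset.prod_ne_zero_iff.mpr fun i _ => Nat.factorial_ne_zero _)
  have h3 : (k.factorial : ℂ) ≠ 0 := Nat.cast_ne_zero.mpr (Nat.factorial_ne_zero _)
  have h4 : ((∏ i, (q i).factorial : ℕ) : ℂ) * (Nat.multinomial Finset.univ q : ℂ) =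
      k.factorial := by exact_mod_cast h1
  rw [taylorCoeff, zero_smul, div_mul_eq_mul_div, div_eq_div_iff h3 h2, ← h4]
  ring

theorem lowPart_eq_sum {Ω : Set (Fin n → ℂ)} (hΩ : IsOpen Ω) (h0 : 0 ∈ Ω)
    {f : (Fin n → ℂ) → ℂ} (hf : AnalyticOnNhd ℂ f Ω) (m : ℕ) (z : Fin n → ℂ) :
    lowPart m f z = ∑ k ∈ Finset.range m, homPart k f z :=
  Finset.sum_congr rfl fun k _ => (homPart_eq_sum hΩ h0 hf k z).symm

theorem differentiableOn_line {Ω : Set (Fin n → ℂ)} {f : (Fin n → ℂ) → ℂ}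
    (hf : AnalyticOnNhd ℂ f Ω) (w : Fin n → ℂ) :
    DifferentiableOn ℂ (fun t : ℂ => f (t • w)) {t | t • w ∈ Ω} := fun t ht => by
  have h1 : DifferentiableAt ℂ (fun t : ℂ => t • w) t := by fun_prop
  exact ((hf _ ht).differentiableAt.comp t h1).differentiableWithinAt

/-- Openness allows `w` to be stretched by some real `r > 1` inside `Ω`, and balancedness fills in
the disc. The margin beyond the unit disc is needed both for the Taylor series at `t = 1` and for
Cauchy's formula on the unit circle. -/
theorem exists_ball_subset_line {Ω : Set (Fin n → ℂ)} (hΩ : IsOpen Ω)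
    (hb : ∀ z ∈ Ω, ∀ t : ℂ, ‖t‖ ≤ 1 → t • z ∈ Ω) {w : Fin n → ℂ} (hw : w ∈ Ω) :
    ∃ r : ℝ, 1 < r ∧ Metric.ball (0 : ℂ) r ⊆ {t | t • w ∈ Ω} := by
  have h1 : ∀ᶠ r : ℝ in 𝓝 1, (r : ℂ) • w ∈ Ω := by
    have hc : Continuous fun r : ℝ => (r : ℂ) • w := by fun_prop
    exact hc.continuousAt.preimage_mem_nhds (hΩ.mem_nhds (by simpa using hw))
  obtain ⟨r, hr, hr1⟩ := ((h1.filter_mono nhdsWithin_le_nhds).and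
    (self_mem_nhdsWithin : Set.Ioi (1 : ℝ) ∈ 𝓝[>] 1)).exists
  have hr1 : 1 < r := hr1
  refine ⟨r, hr1, fun t ht => ?_⟩
  have hr0 : (r : ℂ) ≠ 0 := by exact_mod_cast (by linarith : r ≠ 0)
  have h2 := hb _ hr (t / r) (by
    rw [norm_div, Complex.norm_real, Real.norm_of_nonneg (by linarith)]
    exact div_le_one_of_le₀ (mem_ball_zero_iff.mp ht).le (by linarith))
  rwa [smul_smul, div_mul_cancel₀ _ hr0] at h2

theorem hasSum_homPart {Ω : Set (Fin n → ℂ)} (hΩ : IsOpen Ω)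
    (hb : ∀ z ∈ Ω, ∀ t : ℂ, ‖t‖ ≤ 1 → t • z ∈ Ω) {f : (Fin n → ℂ) → ℂ}
    (hf : AnalyticOnNhd ℂ f Ω) {w : Fin n → ℂ} (hw : w ∈ Ω) :
    HasSum (fun k => homPart k f w) (f w) := by
  obtain ⟨r, hr, hsub⟩ := exists_ball_subset_line hΩ hb hw
  have h := Complex.hasSum_taylorSeries_on_ball ((differentiableOn_line hf w).mono hsub)
    (z := 1) (by simpa using hr)
  simp only [sub_zero, one_pow, one_smul, smul_eq_mul] at h
  convert! h using 2 with k
  rw [homPart, div_eq_inv_mul, one_mul]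

/-- Both sides compute the derivative of order `j + m` of `t ↦ f (t • w)` at `0`, up to the factor
`j!`: the first `m` derivatives are expanded by the multinomial formula, the other `j` act term by
term. -/
theorem sum_homPart_multiDeriv {Ω : Set (Fin n → ℂ)} (hΩ : IsOpen Ω) (h0 : 0 ∈ Ω)
    {f : (Fin n → ℂ) → ℂ} (hf : AnalyticOnNhd ℂ f Ω) (m j : ℕ) (w : Fin n → ℂ) :
    ∑ q ∈ Finset.piAntidiag (Finset.univ : Finset (Fin n)) m,
      (Nat.multinomial Finset.univ q : ℂ) * (∏ i, w i ^ q i) * homPart j (multiDeriv q f) w =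
    (j + m).descFactorial m * homPart (j + m) f w := by
  have h0' : (0 : ℂ) • w ∈ Ω := by simpa using h0
  have h1 : iteratedDeriv (j + m) (fun t : ℂ => f (t • w)) 0 =
      ∑ q ∈ Finset.piAntidiag (Finset.univ : Finset (Fin n)) m,
      (Nat.multinomial Finset.univ q : ℂ) * (∏ i, w i ^ q i) *
        iteratedDeriv j (fun t : ℂ => multiDeriv q f (t • w)) 0 := by
    have h2 : iteratedDeriv m (fun t : ℂ => f (t • w)) =ᶠ[𝓝 0] fun t =>
        ∑ q ∈ Finset.piAntidiag (Finset.univ : Finset (Fin n)) m,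
        (Nat.multinomial Finset.univ q : ℂ) * (∏ i, w i ^ q i) * multiDeriv q f (t • w) := by
      filter_upwards [(continuous_line w).continuousAt.preimage_mem_nhds (hΩ.mem_nhds h0')]
        with s hs using iteratedDeriv_line hΩ hf w m hs
    have h3 : iteratedDeriv (j + m) (fun t : ℂ => f (t • w)) =
        iteratedDeriv j (iteratedDeriv m (fun t : ℂ => f (t • w))) := by
      simp only [iteratedDeriv_eq_iterate, Function.iterate_add_apply]
    have h4 : ∀ q, ContDiffAt ℂ j (fun t : ℂ => multiDeriv q f (t • w)) 0 := fun q => by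
      have h5 : AnalyticAt ℂ (fun t : ℂ => t • w) 0 := by fun_prop
      exact (AnalyticAt.comp (f := fun t : ℂ => t • w)
        (analyticOnNhd_multiDeriv hf q _ h0') h5).contDiffAt
    rw [h3, h2.iteratedDeriv_eq, iteratedDeriv_fun_sum fun q _ => contDiffAt_const.mul (h4 q)]
    exact Finset.sum_congr rfl fun q _ => iteratedDeriv_const_mul_field _ _
  have h6 : (((j + m).descFactorial m : ℕ) : ℂ) = (j + m).factorial / j.factorial := by
    rw [eq_div_iff (Nat.cast_ne_zero.mpr (Nat.factorial_ne_zero _)), mul_comm]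
    have := Nat.factorial_mul_descFactorial (Nat.le_add_left m j)
    rw [Nat.add_sub_cancel] at this
    exact_mod_cast this
  have h7 : ((j + m).factorial : ℂ) ≠ 0 := Nat.cast_ne_zero.mpr (Nat.factorial_ne_zero _)
  rw [h6, homPart, h1, div_mul_div_comm, mul_comm, mul_div_mul_right _ _ h7, Finset.sum_div]
  exact Finset.sum_congr rfl fun q _ => by rw [homPart, mul_div_assoc]

/-- Cauchy's formula for the `k`-th derivative at the centre, applied to `t ↦ f (t • z)` on the unit
circle. -/
theorem integral_circle_eq_homPart {Ω : Set (Fin n → ℂ)} (hΩ : IsOpen Ω)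
    (hb : ∀ z ∈ Ω, ∀ t : ℂ, ‖t‖ ≤ 1 → t • z ∈ Ω) {f : (Fin n → ℂ) → ℂ}
    (hf : AnalyticOnNhd ℂ f Ω) {z : Fin n → ℂ} (hz : z ∈ Ω) (k : ℕ) :
    ∫ θ in (0 : ℝ)..2 * Real.pi, f (circleMap 0 1 θ • z) * (circleMap 0 1 θ ^ k)⁻¹ =
      2 * Real.pi * homPart k f z := by
  obtain ⟨r, hr, hsub⟩ := exists_ball_subset_line hΩ hb hz
  have hd : DiffContOnCl ℂ (fun t : ℂ => f (t • z)) (Metric.ball 0 1) :=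
    ((differentiableOn_line hf z).mono
      ((Metric.closedBall_subset_ball hr).trans hsub)).diffContOnCl_ball subset_rfl
  have h := hd.circleIntegral_one_div_sub_center_pow_smul one_pos k
  rw [circleIntegral] at h
  have h2 : ∀ θ : ℝ, deriv (circleMap 0 1) θ • (1 / (circleMap 0 1 θ - 0) ^ (k + 1)) •
      f (circleMap 0 1 θ • z) =
      Complex.I * (f (circleMap 0 1 θ • z) * (circleMap 0 1 θ ^ k)⁻¹) := fun θ => by
    have h3 : circleMap 0 1 θ ≠ 0 := circleMap_ne_center one_ne_zero
    rw [deriv_circleMap, smul_eq_mul, smul_eq_mul, sub_zero, pow_succ]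
    field_simp
  simp only [h2] at h
  rw [intervalIntegral.integral_const_mul, smul_eq_mul] at h
  apply mul_left_cancel₀ Complex.I_ne_zero
  rw [h, homPart]
  ring

/-! ### Monomial moments of radial weights -/

theorem continuous_hnormSq : Continuous (hnormSq : (Fin n → ℂ) → ℝ) := by
  unfold hnormSq; fun_prop

theorem measurable_hnormSq : Measurable (hnormSq : (Fin n → ℂ) → ℝ) :=
  continuous_hnormSq.measurable

theorem measurableSet_hnormSq_lt (a : ℝ) : MeasurableSet {z : Fin n → ℂ | hnormSq z < a} :=
  measurable_hnormSq measurableSet_Iio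

theorem hnormSq_nonneg (z : Fin n → ℂ) : 0 ≤ hnormSq z :=
  Finset.sum_nonneg fun _ _ => by positivity

theorem hnormSq_smul (t : ℂ) (z : Fin n → ℂ) : hnormSq (t • z) = ‖t‖ ^ 2 * hnormSq z := by
  simp [hnormSq, mul_pow, Finset.mul_sum]

theorem norm_sq_le_hnormSq (z : Fin n → ℂ) (i : Fin n) : ‖z i‖ ^ 2 ≤ hnormSq z :=
  Finset.single_le_sum (f := fun i => ‖z i‖ ^ 2) (fun _ _ => by positivity) (Finset.mem_univ i)

/-- The squared modulus `|z^p|²` of a monomial. -/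
def monoSq (p : Fin n → ℕ) (z : Fin n → ℂ) : ℝ≥0∞ := ∏ i, ‖z i‖ₑ ^ (2 * p i)

theorem measurable_monoSq (p : Fin n → ℕ) : Measurable (monoSq p) := by
  unfold monoSq; fun_prop

theorem monoSq_real_smul (p : Fin n → ℕ) (t : ℝ) (z : Fin n → ℂ) :
    monoSq p (t • z) = ‖t‖ₑ ^ (2 * ∑ i, p i) * monoSq p z := by
  have h : ∀ i, ‖(t • z) i‖ₑ = ‖t‖ₑ * ‖z i‖ₑ := fun i => by
    rw [Pi.smul_apply, enorm_smul]
  simp only [monoSq, h, mul_pow, Finset.prod_mul_distrib, Finset.mul_sum, Finset.prod_pow_eq_pow_sum]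

/-- The distribution of `|z|²` under `|z^p|² dλ(z)`. -/
def monoDist (p : Fin n → ℕ) : Measure ℝ :=
  Measure.map hnormSq ((volume : Measure (Fin n → ℂ)).withDensity (monoSq p))

theorem lintegral_monoDist (p : Fin n → ℕ) {W : ℝ → ℝ≥0∞} (hW : Measurable W) :
    ∫⁻ s, W s ∂monoDist p = ∫⁻ z, monoSq p z * W (hnormSq z) := by
  rw [monoDist, lintegral_map hW measurable_hnormSq]
  exact lintegral_withDensity_eq_lintegral_mul _ (measurable_monoSq p) (hW.comp measurable_hnormSq)

theorem monoDist_Iio (p : Fin n → ℕ) (a : ℝ) :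
    monoDist p (Set.Iio a) = ∫⁻ z in {z : Fin n → ℂ | hnormSq z < a}, monoSq p z := by
  rw [monoDist, Measure.map_apply measurable_hnormSq measurableSet_Iio,
    withDensity_apply _ (measurable_hnormSq measurableSet_Iio)]
  rfl

/-- Dilation by `r` scales `|z^p|²` by `r^{2|p|}` and Lebesgue measure in real dimension `2n` by
`r^{2n}`. The exponent sees `p` only through `|p|`, so multi-indices of equal degree have
proportional distributions. -/
theorem monoDist_Iio_sq (p : Fin n → ℕ) {r : ℝ} (hr : 0 < r) :
    monoDist p (Set.Iio (r ^ 2)) =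
      ENNReal.ofReal r ^ (2 * ∑ i, p i + 2 * n) * monoDist p (Set.Iio 1) := by
  have hn : Module.finrank ℝ (Fin n → ℂ) = 2 * n := by
    rw [Module.finrank_pi_fintype]
    simp [mul_comm]
  have hr' : ENNReal.ofReal r ≠ 0 := by simpa using hr
  have hm : Measurable fun z : Fin n → ℂ => r • z := by fun_prop
  have h := Measure.map_addHaar_smul (volume : Measure (Fin n → ℂ)) hr.ne'
  have hF : Measurable fun z => Set.indicator {z : Fin n → ℂ | hnormSq z < r ^ 2} (monoSq p) z :=
    (measurable_monoSq p).indicator (measurableSet_hnormSq_lt _)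
  have h1 : ∫⁻ z, Set.indicator {z : Fin n → ℂ | hnormSq z < r ^ 2} (monoSq p) (r • z) =
      (ENNReal.ofReal r ^ (2 * n))⁻¹ * monoDist p (Set.Iio (r ^ 2)) := by
    rw [← lintegral_map hF hm, h, lintegral_smul_measure, monoDist_Iio,
      lintegral_indicator (measurableSet_hnormSq_lt _), hn, smul_eq_mul]
    congr 1
    rw [abs_of_nonneg (by positivity), ENNReal.ofReal_inv_of_pos (by positivity),
      ENNReal.ofReal_pow hr.le]
  have h2 : ∫⁻ z, Set.indicator {z : Fin n → ℂ | hnormSq z < r ^ 2} (monoSq p) (r • z) =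
      ENNReal.ofReal r ^ (2 * ∑ i, p i) * monoDist p (Set.Iio 1) := by
    rw [monoDist_Iio, ← lintegral_indicator (measurableSet_hnormSq_lt _),
      ← lintegral_const_mul _ ((measurable_monoSq p).indicator
        (measurableSet_hnormSq_lt _))]
    refine lintegral_congr fun z => ?_
    have h3 : hnormSq (r • z) = r ^ 2 * hnormSq z := by
      have := hnormSq_smul (r : ℂ) z
      rw [Complex.norm_real, Real.norm_of_nonneg hr.le] at this
      rw [← this]
      congr 1
    have h4 : hnormSq (r • z) < r ^ 2 ↔ hnormSq z < 1 := by
      rw [h3, mul_lt_iff_lt_one_right (by positivity)]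
    by_cases hz : hnormSq z < 1
    · rw [Set.indicator_of_mem (show r • z ∈ {z : Fin n → ℂ | hnormSq z < r ^ 2} from h4.mpr hz),
        Set.indicator_of_mem (show z ∈ {z : Fin n → ℂ | hnormSq z < 1} from hz), monoSq_real_smul,
        Real.enorm_of_nonneg hr.le]
    · have hz' : r • z ∉ {z : Fin n → ℂ | hnormSq z < r ^ 2} := fun hc => hz (h4.mp hc)
      have hz'' : z ∉ {z : Fin n → ℂ | hnormSq z < 1} := hz
      rw [Set.indicator_of_notMem hz', Set.indicator_of_notMem hz'', mul_zero]
  rw [h2] at h1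
  have h5 : ENNReal.ofReal r ^ (2 * n) ≠ 0 := pow_ne_zero _ hr'
  have h6 : ENNReal.ofReal r ^ (2 * n) ≠ ∞ := ENNReal.pow_ne_top ENNReal.ofReal_ne_top
  rw [pow_add, mul_right_comm, h1, mul_right_comm, ENNReal.inv_mul_cancel h5 h6, one_mul]

theorem monoDist_Iio_of_nonpos (p : Fin n → ℕ) {a : ℝ} (ha : a ≤ 0) :
    monoDist p (Set.Iio a) = 0 := by
  have : {z : Fin n → ℂ | hnormSq z < a} = ∅ :=
    Set.eq_empty_of_forall_notMem fun z hz => absurd (hnormSq_nonneg z)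
      (not_le.mpr (lt_of_lt_of_le hz ha))
  rw [monoDist_Iio, this]
  simp

theorem monoDist_Iio_one_ne_top (p : Fin n → ℕ) : monoDist p (Set.Iio 1) ≠ ∞ := by
  rw [monoDist_Iio]
  have hsub : {z : Fin n → ℂ | hnormSq z < 1} ⊆ Metric.ball 0 1 := fun z hz => by
    rw [mem_ball_zero_iff, pi_norm_lt_iff one_pos]
    intro i
    have h1 : ‖z i‖ ^ 2 < 1 := (norm_sq_le_hnormSq z i).trans_lt hz
    exact (sq_lt_one_iff₀ (norm_nonneg _)).mp h1
  refine ne_of_lt ?_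
  calc ∫⁻ z in {z : Fin n → ℂ | hnormSq z < 1}, monoSq p z
      ≤ ∫⁻ z in {z : Fin n → ℂ | hnormSq z < 1}, 1 := by
        refine setLIntegral_mono measurable_const fun z hz => ?_
        refine Finset.prod_le_one' fun i _ => pow_le_one' ?_ _
        have h1 : ‖z i‖ < 1 := by
          have := hsub hz
          rw [mem_ball_zero_iff, pi_norm_lt_iff one_pos] at this
          exact this i
        rw [← ofReal_norm, ← ENNReal.ofReal_one]
        exact ENNReal.ofReal_le_ofReal h1.le
    _ = volume {z : Fin n → ℂ | hnormSq z < 1} := by simp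
    _ ≤ volume (Metric.ball (0 : Fin n → ℂ) 1) := measure_mono hsub
    _ < ∞ := measure_ball_lt_top

theorem monoDist_Iio_ne_top (p : Fin n → ℕ) (a : ℝ) : monoDist p (Set.Iio a) ≠ ∞ := by
  rcases le_or_gt a 0 with ha | ha
  · simp [monoDist_Iio_of_nonpos p ha]
  · rw [← Real.sq_sqrt ha.le, monoDist_Iio_sq p (Real.sqrt_pos.mpr ha)]
    exact ENNReal.mul_ne_top (ENNReal.pow_ne_top ENNReal.ofReal_ne_top) (monoDist_Iio_one_ne_top p)

/-- By the scaling law the two measures agree on all half-lines `Iio a`, hence on half-open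
intervals, which determine a locally finite measure. The cross-multiplied form avoids division in
`ℝ≥0∞`. -/
theorem monoDist_smul_eq {p q : Fin n → ℕ} (hpq : ∑ i, p i = ∑ i, q i) :
    monoDist q (Set.Iio 1) • monoDist p = monoDist p (Set.Iio 1) • monoDist q := by
  have hI : ∀ a : ℝ, monoDist q (Set.Iio 1) * monoDist p (Set.Iio a) =
      monoDist p (Set.Iio 1) * monoDist q (Set.Iio a) := fun a => by
    rcases le_or_gt a 0 with ha | ha
    · simp [monoDist_Iio_of_nonpos _ ha]
    · rw [← Real.sq_sqrt ha.le, monoDist_Iio_sq p (Real.sqrt_pos.mpr ha),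
        monoDist_Iio_sq q (Real.sqrt_pos.mpr ha), hpq]
      ring
  have hfin : ∀ (c : ℝ≥0∞) (p : Fin n → ℕ) (a : ℝ), c ≠ ∞ → (c • monoDist p) (Set.Iio a) ≠ ∞ :=
    fun c p a hc => by
      rw [Measure.smul_apply, smul_eq_mul]
      exact ENNReal.mul_ne_top hc (monoDist_Iio_ne_top p a)
  have : IsLocallyFiniteMeasure (monoDist q (Set.Iio 1) • monoDist p) := ⟨fun x =>
    ⟨Set.Iio (x + 1), Iio_mem_nhds (by linarith),
      (hfin _ p _ (monoDist_Iio_one_ne_top q)).lt_top⟩⟩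
  refine Measure.ext_of_Ico _ _ fun a b hab => ?_
  have hd : Set.Ico a b = Set.Iio b \ Set.Iio a := by
    ext x; simp
  have hs : Set.Iio a ⊆ Set.Iio b := Set.Iio_subset_Iio hab.le
  rw [hd, measure_sdiff hs measurableSet_Iio.nullMeasurableSet
      (hfin _ p _ (monoDist_Iio_one_ne_top q)),
    measure_sdiff hs measurableSet_Iio.nullMeasurableSet
      (hfin _ q _ (monoDist_Iio_one_ne_top p))]
  simp only [Measure.smul_apply, smul_eq_mul, hI]

/-- The Gaussian factors over the coordinates, which leaves one-variable Gamma integrals. These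
values calibrate the constants for every other radial weight. -/
theorem lintegral_monoSq_gauss (p : Fin n → ℕ) {ν : ℝ} (hν : 0 < ν) :
    ∫⁻ z : Fin n → ℂ, monoSq p z * ENNReal.ofReal (Real.exp (-ν * hnormSq z)) =
      ENNReal.ofReal (∏ i, (Real.pi / ν ^ (p i + 1) * (p i).factorial)) := by
  have h1 : ∀ k : ℕ, ∫ x : ℂ, ‖x‖ ^ (2 * k) * Real.exp (-ν * ‖x‖ ^ 2) =
      Real.pi / ν ^ (k + 1) * k.factorial := fun k => by
    have h := Complex.integral_rpow_mul_exp_neg_mul_rpow (p := 2) (q := (2 * k : ℕ)) (b := ν)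
      (by norm_num) (by have : (0 : ℝ) ≤ (2 * k : ℕ) := Nat.cast_nonneg _
                        linarith) hν
    simp only [Real.rpow_natCast, Real.rpow_ofNat] at h
    have e1 : (((2 * k : ℕ) : ℝ) + 2) / 2 = (k : ℝ) + 1 := by push_cast; ring
    have e2 : -(((2 * k : ℕ) : ℝ) + 2) / 2 = -((k + 1 : ℕ) : ℝ) := by push_cast; ring
    rw [e1, e2, Real.Gamma_nat_eq_factorial, Real.rpow_neg hν.le, Real.rpow_natCast] at h
    rw [h]
    ring
  have h2 : ∀ z : Fin n → ℂ, monoSq p z * ENNReal.ofReal (Real.exp (-ν * hnormSq z)) =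
      ENNReal.ofReal (∏ i, (‖z i‖ ^ (2 * p i) * Real.exp (-ν * ‖z i‖ ^ 2))) := fun z => by
    rw [Finset.prod_mul_distrib, ENNReal.ofReal_mul (by positivity), ← Real.exp_sum,
      ENNReal.ofReal_prod_of_nonneg fun i _ => by positivity, hnormSq, Finset.mul_sum, monoSq]
    congr 1
    exact Finset.prod_congr rfl fun i _ => by rw [ENNReal.ofReal_pow (norm_nonneg _), ofReal_norm]
  have h3 : ∫ z : Fin n → ℂ, ∏ i, (‖z i‖ ^ (2 * p i) * Real.exp (-ν * ‖z i‖ ^ 2)) =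
      ∏ i, (Real.pi / ν ^ (p i + 1) * (p i).factorial) := by
    rw [integral_fintype_prod_volume_eq_prod
      (f := fun i (x : ℂ) => ‖x‖ ^ (2 * p i) * Real.exp (-ν * ‖x‖ ^ 2))]
    exact Finset.prod_congr rfl fun i _ => h1 _
  have h4 : Integrable fun z : Fin n → ℂ =>
      ∏ i, (‖z i‖ ^ (2 * p i) * Real.exp (-ν * ‖z i‖ ^ 2)) := by
    -- A non-integrable function would have Bochner integral `0`, but the value in `h3` is a product
    -- of positive numbers.
    by_contra hc
    rw [integral_undef hc] at h3
    exact absurd h3.symm (Finset.prod_ne_zero_iff.mpr fun i _ => by positivity)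
  rw [lintegral_congr h2, ← ofReal_integral_eq_lintegral_ofReal h4
    (ae_of_all _ fun z => by positivity), h3]

theorem measurable_gauss (ν : ℝ) : Measurable fun s : ℝ => ENNReal.ofReal (Real.exp (-ν * s)) := by
  fun_prop

/-- If this mass vanished, scaling would annihilate the whole distribution, against the positive
Gaussian moment. -/
theorem monoDist_Iio_one_ne_zero (p : Fin n → ℕ) : monoDist p (Set.Iio 1) ≠ 0 := fun h => by
  have h0 : ∀ a, monoDist p (Set.Iio a) = 0 := fun a => by
    rcases le_or_gt a 0 with ha | ha
    · exact monoDist_Iio_of_nonpos p ha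
    · rw [← Real.sq_sqrt ha.le, monoDist_Iio_sq p (Real.sqrt_pos.mpr ha), h, mul_zero]
  have h1 : monoDist p = 0 := by
    have hu : (⋃ k : ℕ, Set.Iio (k : ℝ)) = Set.univ :=
      Set.eq_univ_of_forall fun x => Set.mem_iUnion.mpr (exists_nat_gt x)
    rw [← Measure.measure_univ_eq_zero, ← hu]
    exact measure_iUnion_null fun k => h0 _
  have h2 := lintegral_monoDist p (measurable_gauss 1)
  rw [h1, lintegral_monoSq_gauss p one_pos] at h2
  have h3 : 0 < ∏ i, (Real.pi / 1 ^ (p i + 1) * (p i).factorial) :=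
    Finset.prod_pos fun i _ => by positivity
  simp at h2
  exact absurd h2 (by simpa using h3)

/-- The ratio of the two distributions does not depend on `W`, so it can be read off from `W(s) =
e^{-s}`, where the integral for `p` is `π^n p!`. No polar coordinates are needed. -/
theorem factorial_mul_lintegral_monoSq {p q : Fin n → ℕ} (hpq : ∑ i, p i = ∑ i, q i)
    {W : ℝ → ℝ≥0∞} (hW : Measurable W) :
    ((∏ i, (q i).factorial : ℕ) : ℝ≥0∞) * ∫⁻ z, monoSq p z * W (hnormSq z) =
      ((∏ i, (p i).factorial : ℕ) : ℝ≥0∞) * ∫⁻ z, monoSq q z * W (hnormSq z) := by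
  have key : ∀ {W : ℝ → ℝ≥0∞}, Measurable W →
      monoDist q (Set.Iio 1) * ∫⁻ z, monoSq p z * W (hnormSq z) =
      monoDist p (Set.Iio 1) * ∫⁻ z, monoSq q z * W (hnormSq z) := fun {W} hW => by
    rw [← lintegral_monoDist p hW, ← lintegral_monoDist q hW, ← smul_eq_mul, ← smul_eq_mul,
      ← lintegral_smul_measure, ← lintegral_smul_measure, monoDist_smul_eq hpq]
  have hg : ∀ p : Fin n → ℕ, ENNReal.ofReal (∏ i, (Real.pi / 1 ^ (p i + 1) * (p i).factorial)) =
      ENNReal.ofReal (Real.pi ^ n) * ((∏ i, (p i).factorial : ℕ) : ℝ≥0∞) := fun p => by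
    rw [← ENNReal.ofReal_natCast, ← ENNReal.ofReal_mul (by positivity)]
    simp [Finset.prod_mul_distrib]
  have h1 := key (measurable_gauss 1)
  rw [lintegral_monoSq_gauss p one_pos, lintegral_monoSq_gauss q one_pos, hg, hg] at h1
  have hπ : ENNReal.ofReal (Real.pi ^ n) ≠ 0 := by
    rw [ne_eq, ENNReal.ofReal_eq_zero, not_le]; positivity
  have h2 : monoDist q (Set.Iio 1) * ((∏ i, (p i).factorial : ℕ) : ℝ≥0∞) =
      monoDist p (Set.Iio 1) * ((∏ i, (q i).factorial : ℕ) : ℝ≥0∞) := by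
    rw [mul_left_comm, mul_left_comm (monoDist p _)] at h1
    exact (ENNReal.mul_right_inj hπ ENNReal.ofReal_ne_top).mp h1
  have h3 := key hW
  refine (ENNReal.mul_right_inj (monoDist_Iio_one_ne_zero p) (monoDist_Iio_one_ne_top p)).mp ?_
  rw [← mul_assoc, ← h2, mul_right_comm, h3]
  ring

/-! ### Radial weights -/

/-- The Hermitian inner product, linear in the first argument. -/
def hin (z w : Fin n → ℂ) : ℂ := ∑ i, z i * conj (w i)

/-- The monomial `z^p`. -/
def mono (p : Fin n → ℕ) (z : Fin n → ℂ) : ℂ := ∏ i, z i ^ p i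

/-- A measure with radial density and finite moments, concentrated on a balanced open set `Ω`, with
enough mass near the boundary of `Ω` for the kernels to converge on `Ω × Ω`. -/
structure IsRadialWeight (Ω : Set (Fin n → ℂ)) (μ : Measure (Fin n → ℂ)) : Prop where
  isOpen : IsOpen Ω
  balanced : ∀ z ∈ Ω, ∀ t : ℂ, ‖t‖ ≤ 1 → t • z ∈ Ω
  exists_density : ∃ W : ℝ → ℝ≥0∞, Measurable W ∧ μ = volume.withDensity fun z => W (hnormSq z)
  null_compl : μ Ωᶜ = 0
  lintegral_ne_top : ∀ (i : Fin n) (k : ℕ), ∫⁻ z, ‖z i‖ₑ ^ (2 * k) ∂μ ≠ ∞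
  mass : ∀ z ∈ Ω, ∀ w ∈ Ω, ∃ ρ : ℝ, ‖hin z w‖ < ρ ∧ ∀ i, μ {z | ρ ≤ ‖z i‖ ^ 2} ≠ 0

/-- The moments `∫ |z_i|^{2k} dμ`. -/
def moment (μ : Measure (Fin n → ℂ)) (i : Fin n) (k : ℕ) : ℝ := ∫ z, ‖z i‖ ^ (2 * k) ∂μ

theorem continuous_hin_left (w : Fin n → ℂ) : Continuous fun z => hin z w := by
  unfold hin; fun_prop

theorem continuous_mono (p : Fin n → ℕ) : Continuous (mono p) := by
  unfold mono; fun_prop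

theorem hin_smul_left (t : ℂ) (z w : Fin n → ℂ) : hin (t • z) w = t * hin z w := by
  simp [hin, Finset.mul_sum, mul_assoc]

theorem conj_hin (z w : Fin n → ℂ) : conj (hin z w) = hin w z := by
  simp [hin, mul_comm]

theorem hin_self (w : Fin n → ℂ) : hin w w = hnormSq w := by
  simp [hin, hnormSq, Complex.mul_conj, Complex.normSq_eq_norm_sq]

theorem hin_pow (z w : Fin n → ℂ) (k : ℕ) : hin z w ^ k =
    ∑ q ∈ Finset.piAntidiag (Finset.univ : Finset (Fin n)) k,
      (Nat.multinomial Finset.univ q : ℂ) * (mono q z * conj (mono q w)) := by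
  rw [hin, Finset.sum_pow_eq_sum_piAntidiag]
  simp [mono, mul_pow, Finset.prod_mul_distrib]

theorem enorm_mono_sq (p : Fin n → ℕ) (z : Fin n → ℂ) : ‖mono p z‖ₑ ^ 2 = monoSq p z := by
  have h : ‖mono p z‖ₑ = ∏ i, ‖z i‖ₑ ^ p i := by
    simp only [← ofReal_norm, mono, norm_prod, norm_pow]
    rw [ENNReal.ofReal_prod_of_nonneg fun i _ => by positivity]
    exact Finset.prod_congr rfl fun i _ => ENNReal.ofReal_pow (norm_nonneg _) _
  rw [h, monoSq, ← Finset.prod_pow]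
  exact Finset.prod_congr rfl fun i _ => by rw [← pow_mul, mul_comm]

theorem memLp_two_iff {α : Type*} {_ : MeasurableSpace α} {μ : Measure α} {f : α → ℂ}
    (hf : AEStronglyMeasurable f μ) : MemLp f 2 μ ↔ ∫⁻ z, ‖f z‖ₑ ^ 2 ∂μ < ∞ := by
  rw [MemLp, and_iff_right hf, eLpNorm_lt_top_iff_lintegral_rpow_enorm_lt_top (by simp) (by simp)]
  simp

/-! ### Orthogonality of monomials and pairing with powers of the inner product -/

namespace IsRadialWeight

variable {Ω : Set (Fin n → ℂ)} {μ : Measure (Fin n → ℂ)}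

theorem sFinite (h : IsRadialWeight Ω μ) : SFinite μ := by
  obtain ⟨W, -, rfl⟩ := h.exists_density
  infer_instance

theorem ae_mem (h : IsRadialWeight Ω μ) : ∀ᵐ z ∂μ, z ∈ Ω := by
  rw [ae_iff]
  exact h.null_compl

theorem aestronglyMeasurable (h : IsRadialWeight Ω μ) {f : (Fin n → ℂ) → ℂ}
    (hf : ContinuousOn f Ω) : AEStronglyMeasurable f μ := by
  rw [← Measure.restrict_eq_self_of_ae_mem h.ae_mem]
  exact hf.aestronglyMeasurable h.isOpen.measurableSet

theorem measurePreserving (h : IsRadialWeight Ω μ) (c : Fin n → Circle) :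
    MeasurePreserving (fun z i => (c i : ℂ) * z i) μ μ := by
  obtain ⟨W, hW, rfl⟩ := h.exists_density
  have hv : MeasurePreserving (fun (z : Fin n → ℂ) i => (c i : ℂ) * z i) volume volume :=
    volume_preserving_pi (f := fun i (x : ℂ) => (c i : ℂ) * x) fun i =>
      (rotation (c i)).measurePreserving
  have hn : ∀ z : Fin n → ℂ, hnormSq (fun i => (c i : ℂ) * z i) = hnormSq z := fun z => by
    simp only [hnormSq, norm_mul, Circle.norm_coe, one_mul]
  have hWm : Measurable fun z : Fin n → ℂ => W (hnormSq z) := hW.comp measurable_hnormSq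
  refine ⟨hv.measurable, Measure.ext fun s hs => ?_⟩
  rw [Measure.map_apply hv.measurable hs, withDensity_apply _ (hv.measurable hs),
    withDensity_apply _ hs, ← hv.setLIntegral_comp_preimage hs hWm]
  simp only [hn]

theorem measurableEmbedding_mul (c : Fin n → Circle) :
    MeasurableEmbedding fun (z : Fin n → ℂ) i => (c i : ℂ) * z i := by
  refine Continuous.measurableEmbedding (by fun_prop) fun z w hzw => ?_
  ext i
  exact mul_left_cancel₀ (Circle.coe_ne_zero (c i)) (congrFun hzw i)

theorem integral_comp_mul (h : IsRadialWeight Ω μ) (c : Fin n → Circle) (f : (Fin n → ℂ) → ℂ) :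
    ∫ z, f (fun i => (c i : ℂ) * z i) ∂μ = ∫ z, f z ∂μ :=
  (h.measurePreserving c).integral_comp (measurableEmbedding_mul c) f

/-- Rotating one coordinate with `p i ≠ q i` by the angle `π / (p i - q i)` preserves `μ` and
changes the sign of the integrand. -/
theorem integral_mono_mul_conj_eq_zero (h : IsRadialWeight Ω μ) {p q : Fin n → ℕ} (hpq : p ≠ q) :
    ∫ z, mono p z * conj (mono q z) ∂μ = 0 := by
  obtain ⟨i, hi⟩ := Function.ne_iff.mp hpq
  have hd : (p i : ℝ) - q i ≠ 0 := sub_ne_zero.mpr (by exact_mod_cast hi)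
  set c : Circle := Circle.exp (Real.pi / (p i - q i)) with hc
  have hc1 : (c : ℂ) ^ p i * conj (c : ℂ) ^ q i = -1 := by
    have h1 : (c : ℂ) ^ p i * conj (c : ℂ) ^ q i =
        ((Circle.exp (p i * (Real.pi / (p i - q i)) + -(q i * (Real.pi / (p i - q i)))) : Circle) : ℂ) := by
      rw [Circle.exp_add, Circle.exp_neg, Circle.coe_mul, Circle.coe_inv_eq_conj]
      simp only [hc, Circle.coe_exp, ← Complex.exp_nat_mul, ← map_pow]
      push_cast
      congr 2 <;> ring_nf
    have h2 : (p i * (Real.pi / (p i - q i)) + -(q i * (Real.pi / (p i - q i))) : ℝ) = Real.pi := by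
      field_simp
      ring
    rw [h1, h2, Circle.coe_exp, Complex.exp_pi_mul_I]
  have hm : ∀ (r : Fin n → ℕ) (z : Fin n → ℂ),
      mono r (fun j => ((Pi.mulSingle i c : Fin n → Circle) j : ℂ) * z j) =
      (c : ℂ) ^ r i * mono r z := fun r z => by
    simp only [mono, mul_pow, Finset.prod_mul_distrib]
    congr 1
    rw [Finset.prod_eq_single i]
    · simp
    · intro j _ hj
      simp [Pi.mulSingle_eq_of_ne hj]
    · simp
  have h3 := h.integral_comp_mul (Pi.mulSingle i c) fun z => mono p z * conj (mono q z)
  have h4 : ∀ z, mono p (fun j => ((Pi.mulSingle i c : Fin n → Circle) j : ℂ) * z j) *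
      conj (mono q (fun j => ((Pi.mulSingle i c : Fin n → Circle) j : ℂ) * z j)) =
      -(mono p z * conj (mono q z)) := fun z => by
    rw [hm, hm, map_mul, map_pow, mul_mul_mul_comm, hc1]
    ring
  simp only [h4, integral_neg] at h3
  exact self_eq_neg.mp h3.symm

/-- The comparison of equal degrees, taken against the multi-index concentrated at `i`. -/
theorem lintegral_monoSq (h : IsRadialWeight Ω μ) (i : Fin n) (p : Fin n → ℕ) :
    (((∑ j, p j).factorial : ℕ) : ℝ≥0∞) * ∫⁻ z, monoSq p z ∂μ =
      ((∏ j, (p j).factorial : ℕ) : ℝ≥0∞) * ∫⁻ z, ‖z i‖ₑ ^ (2 * ∑ j, p j) ∂μ := by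
  obtain ⟨W, hW, rfl⟩ := h.exists_density
  have hWm : Measurable fun z : Fin n → ℂ => W (hnormSq z) := hW.comp measurable_hnormSq
  have h1 := factorial_mul_lintegral_monoSq (p := p) (q := Pi.single i (∑ j, p j))
    (by simp) hW
  have h2 : ∏ j, ((Pi.single i (∑ j, p j) : Fin n → ℕ) j).factorial = (∑ j, p j).factorial := by
    rw [Finset.prod_eq_single i]
    · simp
    · intro j _ hj
      simp [Pi.single_eq_of_ne hj]
    · simp
  have h3 : ∀ z : Fin n → ℂ, monoSq (Pi.single i (∑ j, p j)) z = ‖z i‖ₑ ^ (2 * ∑ j, p j) :=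
    fun z => by
    rw [monoSq, Finset.prod_eq_single i]
    · simp
    · intro j _ hj
      simp [Pi.single_eq_of_ne hj]
    · simp
  rw [h2] at h1
  simp only [h3] at h1
  rw [lintegral_withDensity_eq_lintegral_mul _ hWm (measurable_monoSq p),
    lintegral_withDensity_eq_lintegral_mul _ hWm (by fun_prop)]
  simpa only [Pi.mul_apply, mul_comm] using h1

theorem memLp_mono (h : IsRadialWeight Ω μ) (i : Fin n) (p : Fin n → ℕ) : MemLp (mono p) 2 μ := by
  rw [memLp_two_iff (continuous_mono p).aestronglyMeasurable]
  simp only [enorm_mono_sq]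
  have h1 := h.lintegral_monoSq i p
  have h2 : (((∑ j, p j).factorial : ℕ) : ℝ≥0∞) * ∫⁻ z, monoSq p z ∂μ ≠ ∞ := by
    rw [h1]
    exact ENNReal.mul_ne_top (ENNReal.natCast_ne_top _) (h.lintegral_ne_top i _)
  exact (ENNReal.lt_top_of_mul_ne_top_right h2
    (Nat.cast_ne_zero.mpr (Nat.factorial_ne_zero _)))

theorem moment_eq_toReal (μ : Measure (Fin n → ℂ)) (i : Fin n) (k : ℕ) :
    moment μ i k = (∫⁻ z, ‖z i‖ₑ ^ (2 * k) ∂μ).toReal := by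
  rw [moment, integral_eq_lintegral_of_nonneg_ae (ae_of_all _ fun z => by positivity)
    (Continuous.aestronglyMeasurable (by fun_prop))]
  simp [ENNReal.ofReal_pow]

theorem integral_mono_mul_conj_self (h : IsRadialWeight Ω μ) (i : Fin n) (p : Fin n → ℕ) :
    ((∑ j, p j).factorial : ℂ) * ∫ z, mono p z * conj (mono p z) ∂μ =
      ((∏ j, (p j).factorial : ℕ) : ℂ) * moment μ i (∑ j, p j) := by
  have h1 : ∫ z, mono p z * conj (mono p z) ∂μ = ((∫⁻ z, monoSq p z ∂μ).toReal : ℂ) := by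
    have h2 : ∀ z, mono p z * conj (mono p z) = ((‖mono p z‖ ^ 2 : ℝ) : ℂ) := fun z => by
      rw [Complex.mul_conj, Complex.normSq_eq_norm_sq]
    simp only [h2, integral_complex_ofReal]
    congr 1
    rw [integral_eq_lintegral_of_nonneg_ae (f := fun z => ‖mono p z‖ ^ 2)
      (ae_of_all _ fun z => by positivity)
      (((continuous_mono p).norm.pow 2).aestronglyMeasurable)]
    congr 1
    refine lintegral_congr fun z => ?_
    rw [← enorm_mono_sq, ENNReal.ofReal_pow (norm_nonneg _), ofReal_norm]
  have h3 := congrArg ENNReal.toReal (h.lintegral_monoSq i p)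
  rw [ENNReal.toReal_mul, ENNReal.toReal_mul, ENNReal.toReal_natCast, ENNReal.toReal_natCast,
    ← moment_eq_toReal] at h3
  rw [h1]
  exact_mod_cast h3

/-- Orthogonality leaves only the term `q = p` of the multinomial expansion, and its coefficient
`k!/p!` cancels the ratio `p!/k!` between `∫ |z^p|² dμ` and the moment. -/
theorem integral_mono_mul_conj_hin_pow (h : IsRadialWeight Ω μ) (i : Fin n) (p : Fin n → ℕ)
    (w : Fin n → ℂ) (k : ℕ) : ∫ z, mono p z * conj (hin z w ^ k) ∂μ =
      if ∑ j, p j = k then moment μ i k * mono p w else 0 := by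
  have h1 : ∀ z, mono p z * conj (hin z w ^ k) =
      ∑ q ∈ Finset.piAntidiag (Finset.univ : Finset (Fin n)) k,
        ((Nat.multinomial Finset.univ q : ℂ) * mono q w) * (mono p z * conj (mono q z)) := fun z => by
    rw [hin_pow, map_sum, Finset.mul_sum]
    refine Finset.sum_congr rfl fun q _ => ?_
    simp only [map_mul, Complex.conj_conj, map_natCast]
    ring
  have hint : ∀ q, Integrable (fun z => mono p z * conj (mono q z)) μ := fun q =>
    (h.memLp_mono i p).integrable_mul (h.memLp_mono i q).star
  simp only [h1]
  rw [integral_finsetSum _ fun q _ => (hint q).const_mul _]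
  simp only [integral_const_mul]
  by_cases hp : ∑ j, p j = k
  · rw [if_pos hp, Finset.sum_eq_single p]
    · have h2 := Nat.multinomial_spec Finset.univ p
      have h3 := h.integral_mono_mul_conj_self i p
      have h4 : ((∏ i, (p i).factorial : ℕ) : ℂ) ≠ 0 :=
        Nat.cast_ne_zero.mpr (Finset.prod_ne_zero_iff.mpr fun i _ => Nat.factorial_ne_zero _)
      have h5 : ((∏ i, (p i).factorial : ℕ) : ℂ) * (Nat.multinomial Finset.univ p : ℂ) =
        (∑ j, p j).factorial := by exact_mod_cast h2
      apply mul_left_cancel₀ h4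
      rw [← h5, hp] at h3
      linear_combination (mono p w) * h3
    · intro q _ hq
      rw [h.integral_mono_mul_conj_eq_zero (Ne.symm hq), mul_zero]
    · intro hp'
      exact absurd (Finset.mem_piAntidiag.mpr ⟨hp, by simp⟩) hp'
  · rw [if_neg hp]
    refine Finset.sum_eq_zero fun q hq => ?_
    rw [h.integral_mono_mul_conj_eq_zero, mul_zero]
    rintro rfl
    exact hp (Finset.mem_piAntidiag.mp hq).1

theorem memLp_hin_pow (h : IsRadialWeight Ω μ) (i : Fin n) (w : Fin n → ℂ) (k : ℕ) :
    MemLp (fun z => hin z w ^ k) 2 μ := by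
  simp only [hin_pow]
  refine memLp_finsetSum _ fun q _ => ?_
  have h1 : (fun z => (Nat.multinomial Finset.univ q : ℂ) * (mono q z * conj (mono q w))) =
      fun z => ((Nat.multinomial Finset.univ q : ℂ) * conj (mono q w)) * mono q z := by
    ext z; ring
  rw [h1]
  exact (h.memLp_mono i q).const_mul _

theorem memLp_homPart (h : IsRadialWeight Ω μ) (h0 : 0 ∈ Ω) (i : Fin n) {f : (Fin n → ℂ) → ℂ}
    (hf : AnalyticOnNhd ℂ f Ω) (k : ℕ) : MemLp (homPart k f) 2 μ := by
  have h1 : homPart k f = fun w => ∑ q ∈ Finset.piAntidiag (Finset.univ : Finset (Fin n)) k,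
      taylorCoeff f q * mono q w := funext fun w => homPart_eq_sum h.isOpen h0 hf k w
  rw [h1]
  exact memLp_finsetSum _ fun q _ => (h.memLp_mono i q).const_mul _

theorem integral_homPart_mul_conj_hin_pow (h : IsRadialWeight Ω μ) (h0 : 0 ∈ Ω) (i : Fin n)
    {f : (Fin n → ℂ) → ℂ} (hf : AnalyticOnNhd ℂ f Ω) (w : Fin n → ℂ) (k j : ℕ) :
    ∫ z, homPart k f z * conj (hin z w ^ j) ∂μ =
      if k = j then moment μ i k * homPart k f w else 0 := by
  have h1 : ∀ w, homPart k f w = ∑ q ∈ Finset.piAntidiag (Finset.univ : Finset (Fin n)) k,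
      taylorCoeff f q * mono q w := fun w => homPart_eq_sum h.isOpen h0 hf k w
  simp only [h1, Finset.sum_mul, mul_assoc]
  have hint : ∀ q, Integrable (fun z => taylorCoeff f q * (mono q z * conj (hin z w ^ j))) μ :=
    fun q => Integrable.const_mul ((h.memLp_mono i q).integrable_mul (h.memLp_hin_pow i w j).star) _
  rw [integral_finsetSum _ fun q _ => hint q]
  simp only [integral_const_mul]
  have h2 : ∀ q ∈ Finset.piAntidiag (Finset.univ : Finset (Fin n)) k, taylorCoeff f q *
      ∫ z, mono q z * conj (hin z w ^ j) ∂μ =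
      if k = j then moment μ i k * (taylorCoeff f q * mono q w) else 0 := fun q hq => by
    rw [h.integral_mono_mul_conj_hin_pow i, (Finset.mem_piAntidiag.mp hq).1]
    split_ifs with hkj
    · rw [hkj]; ring
    · simp
  rw [Finset.sum_congr rfl h2]
  split_ifs
  · rw [Finset.mul_sum]
  · simp

/-- The integral is unchanged when `z` is rotated by `e^{iθ}`. Averaging over `θ` and applying
Fubini replaces `g` by its homogeneous part of degree `k`, by Cauchy's formula on each circle. This
avoids convergence of the Taylor series of `g` in `L²(μ)`. -/
theorem integral_mul_conj_hin_pow (h : IsRadialWeight Ω μ) (h0 : 0 ∈ Ω) (i : Fin n)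
    {g : (Fin n → ℂ) → ℂ} (hg : AnalyticOnNhd ℂ g Ω) (hg2 : MemLp g 2 μ) (w : Fin n → ℂ) (k : ℕ) :
    ∫ z, g z * conj (hin z w ^ k) ∂μ = moment μ i k * homPart k g w := by
  classical
  have := h.sFinite
  -- Nothing is known of `g` off `Ω`; its extension by zero is Borel measurable on all of `ℂⁿ`,
  -- which the product measurability for Fubini needs.
  set H : (Fin n → ℂ) → ℂ := fun z => Ω.indicator g z * conj (hin z w ^ k) with hH
  have hgm : Measurable (Ω.indicator g) := by
    have := hg.continuousOn.measurable_piecewise (g := fun _ => (0 : ℂ)) continuousOn_const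
      h.isOpen.measurableSet
    rwa [← Set.piecewise_eq_indicator]
  have hHm : Measurable H := by
    have := (continuous_hin_left w).measurable
    fun_prop
  have hgH : (fun z => g z * conj (hin z w ^ k)) =ᵐ[μ] H := by
    filter_upwards [h.ae_mem] with z hz
    rw [hH]
    simp only [Set.indicator_of_mem hz]
  have hHi : Integrable H μ :=
    (hg2.integrable_mul (h.memLp_hin_pow i w k).star).congr hgH
  have hcirc : ∀ (θ : ℝ) (z : Fin n → ℂ),
      (fun i => ((Circle.exp θ : Circle) : ℂ) * z i) = circleMap 0 1 θ • z := fun θ z => by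
    ext i; simp [circleMap]
  have hrot : ∀ θ : ℝ, ∫ z, H (circleMap 0 1 θ • z) ∂μ = ∫ z, H z ∂μ := fun θ => by
    have := h.integral_comp_mul (fun _ => Circle.exp θ) H
    simpa only [hcirc] using this
  have hrotn : ∀ θ : ℝ, ∫ z, ‖H (circleMap 0 1 θ • z)‖ ∂μ = ∫ z, ‖H z‖ ∂μ := fun θ => by
    have := (h.measurePreserving (fun _ => Circle.exp θ)).integral_comp
      (measurableEmbedding_mul _) (fun z => ‖H z‖)
    simpa only [hcirc] using this
  have hroti : ∀ θ : ℝ, Integrable (fun z => H (circleMap 0 1 θ • z)) μ := fun θ => by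
    have := ((h.measurePreserving (fun _ => Circle.exp θ)).integrable_comp_emb
      (measurableEmbedding_mul _)).mpr hHi
    simpa only [Function.comp_def, hcirc] using this
  have hprod : Integrable (Function.uncurry fun (θ : ℝ) z => H (circleMap 0 1 θ • z))
      ((volume.restrict (Set.Ioc 0 (2 * Real.pi))).prod μ) := by
    have hm : Measurable (Function.uncurry fun (θ : ℝ) (z : Fin n → ℂ) =>
        H (circleMap 0 1 θ • z)) := by
      have h1 : Continuous fun x : ℝ × (Fin n → ℂ) => circleMap 0 1 x.1 • x.2 :=
        ((continuous_circleMap 0 1).comp continuous_fst).smul continuous_snd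
      exact hHm.comp h1.measurable
    rw [integrable_prod_iff hm.aestronglyMeasurable]
    refine ⟨ae_of_all _ hroti, ?_⟩
    simp only [Function.uncurry_apply_pair, hrotn]
    exact integrable_const _
  have hswap := integral_integral_swap hprod
  have hinner : ∀ᵐ z ∂μ, ∫ θ in Set.Ioc 0 (2 * Real.pi), H (circleMap 0 1 θ • z) =
      2 * Real.pi * (homPart k g z * conj (hin z w ^ k)) := by
    filter_upwards [h.ae_mem] with z hz
    rw [← intervalIntegral.integral_of_le Real.two_pi_pos.le, ← mul_assoc,
      ← integral_circle_eq_homPart h.isOpen h.balanced hg hz k,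
      ← intervalIntegral.integral_mul_const]
    refine intervalIntegral.integral_congr fun θ _ => ?_
    have hz' : circleMap 0 1 θ • z ∈ Ω := h.balanced z hz _ (by simp)
    have hc : conj (circleMap 0 1 θ ^ k) = (circleMap 0 1 θ ^ k)⁻¹ := by
      rw [← Complex.inv_eq_conj (by simp)]
    simp only [hH, Set.indicator_of_mem hz', hin_smul_left, mul_pow, map_mul (starRingEnd ℂ), hc]
    ring
  simp only [hrot] at hswap
  rw [integral_congr_ae hinner, integral_const_mul,
    h.integral_homPart_mul_conj_hin_pow h0 i hg w k k, if_pos rfl] at hswap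
  have hpi : (2 * Real.pi : ℂ) ≠ 0 := by
    exact_mod_cast Real.two_pi_pos.ne'
  apply mul_left_cancel₀ hpi
  rw [integral_congr_ae hgH, ← hswap, integral_const, Complex.real_smul]
  simp [Real.pi_pos.le]

end IsRadialWeight

/-! ### Power series in one variable -/

/-- The power series `∑ b_k x^k`. -/
def powSeries (b : ℕ → ℂ) (x : ℂ) : ℂ := ∑' k, b k * x ^ k

theorem hasFPowerSeriesOnBall_powSeries {b : ℕ → ℂ} {C ρ : ℝ} (hρ : 0 < ρ)
    (hb : ∀ k, ‖b k‖ * ρ ^ k ≤ C) :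
    HasFPowerSeriesOnBall (powSeries b) (FormalMultilinearSeries.ofScalars ℂ b) 0
      (ENNReal.ofReal ρ) := by
  have hle : ENNReal.ofReal ρ ≤ (FormalMultilinearSeries.ofScalars ℂ b).radius := by
    refine FormalMultilinearSeries.le_radius_of_bound (r := ρ.toNNReal) _ C fun k => ?_
    rw [FormalMultilinearSeries.ofScalars_norm, Real.coe_toNNReal _ hρ.le]
    exact hb k
  have h0 : 0 < ENNReal.ofReal ρ := ENNReal.ofReal_pos.mpr hρ
  have h1 := (FormalMultilinearSeries.hasFPowerSeriesOnBall _ (h0.trans_le hle)).mono h0 hle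
  have h2 : powSeries b = (FormalMultilinearSeries.ofScalars ℂ b).sum := by
    have := FormalMultilinearSeries.ofScalarsSum_eq_tsum (E := ℂ) b
    rw [FormalMultilinearSeries.ofScalarsSum] at this
    rw [this]
    rfl
  rwa [h2]

theorem analyticOnNhd_powSeries {b : ℕ → ℂ} {C ρ : ℝ} (hρ : 0 < ρ)
    (hb : ∀ k, ‖b k‖ * ρ ^ k ≤ C) : AnalyticOnNhd ℂ (powSeries b) (Metric.ball 0 ρ) := by
  rw [← Metric.eball_ofReal]
  exact (hasFPowerSeriesOnBall_powSeries hρ hb).analyticOnNhd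

theorem iteratedDeriv_powSeries_zero {b : ℕ → ℂ} {C ρ : ℝ} (hρ : 0 < ρ)
    (hb : ∀ k, ‖b k‖ * ρ ^ k ≤ C) (k : ℕ) :
    iteratedDeriv k (powSeries b) 0 = k.factorial * b k := by
  rw [iteratedDeriv_eq_iteratedFDeriv,
    ← (hasFPowerSeriesOnBall_powSeries hρ hb).factorial_smul 1 k]
  simp

theorem hasSum_iteratedDeriv_powSeries {b : ℕ → ℂ} {C ρ : ℝ} (hρ : 0 < ρ)
    (hb : ∀ k, ‖b k‖ * ρ ^ k ≤ C) (m : ℕ) {x : ℂ} (hx : ‖x‖ < ρ) :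
    HasSum (fun j => ((j + m).descFactorial m * b (j + m)) * x ^ j)
      (iteratedDeriv m (powSeries b) x) := by
  have h1 : DifferentiableOn ℂ (iteratedDeriv m (powSeries b)) (Metric.ball 0 ρ) := by
    rw [iteratedDeriv_eq_iterate]
    exact ((analyticOnNhd_powSeries hρ hb).iterated_deriv m).differentiableOn
  have h2 := Complex.hasSum_taylorSeries_on_ball h1 (z := x) (by simpa using hx)
  convert! h2 using 2 with j
  have h3 : iteratedDeriv j (iteratedDeriv m (powSeries b)) 0 =
      (j + m).factorial * b (j + m) := by
    rw [← iteratedDeriv_powSeries_zero hρ hb]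
    simp only [iteratedDeriv_eq_iterate, Function.iterate_add_apply]
  have h4 : ((j + m).factorial : ℂ) = j.factorial * (j + m).descFactorial m := by
    have := Nat.factorial_mul_descFactorial (Nat.le_add_left m j)
    rw [Nat.add_sub_cancel] at this
    exact_mod_cast this.symm
  have h5 : (j.factorial : ℂ) ≠ 0 := Nat.cast_ne_zero.mpr (Nat.factorial_ne_zero _)
  rw [h3, h4, sub_zero, smul_eq_mul, smul_eq_mul]
  field_simp

/-! ### Functions of the inner product -/

/-- The form `z ↦ ⟨z, w⟩` as a continuous linear map. -/
def hinL (w : Fin n → ℂ) : (Fin n → ℂ) →L[ℂ] ℂ :=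
  ∑ i, conj (w i) • ContinuousLinearMap.proj (R := ℂ) (φ := fun _ : Fin n => ℂ) i

theorem hinL_apply (z w : Fin n → ℂ) : hinL w z = hin z w := by
  simp [hinL, hin, mul_comm]

theorem coe_hinL (w : Fin n → ℂ) : (hinL w : (Fin n → ℂ) → ℂ) = fun z => hin z w :=
  funext fun z => hinL_apply z w

theorem analyticAt_hin (z w : Fin n → ℂ) : AnalyticAt ℂ (fun z => hin z w) z := by
  rw [← coe_hinL]
  exact (hinL w).analyticAt z

theorem pderiv_const_mul_comp_hin {h : ℂ → ℂ} {z w : Fin n → ℂ}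
    (hh : DifferentiableAt ℂ h (hin z w)) (c : ℂ) (i : Fin n) :
    pderiv i (fun z => c * h (hin z w)) z = conj (w i) * c * deriv h (hin z w) := by
  have h1 : HasFDerivAt (fun z => hin z w) (hinL w) z := by
    rw [← coe_hinL]
    exact (hinL w).hasFDerivAt
  have h2 := (hh.hasDerivAt.comp_hasFDerivAt z h1).const_mul c
  have h3 : hin (Pi.single i 1) w = conj (w i) := by
    rw [hin, Finset.sum_eq_single i] <;> simp +contextual
  rw [pderiv]
  simp only [Function.comp_def] at h2
  rw [h2.fderiv]
  simp only [smul_apply, hinL_apply, h3, smul_eq_mul]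
  ring

theorem isOpen_norm_hin_lt (w : Fin n → ℂ) (ρ : ℝ) : IsOpen {z | ‖hin z w‖ < ρ} :=
  isOpen_lt (continuous_hin_left w).norm continuous_const

/-- Each `∂/∂z_i` brings down `conj (w i)` and differentiates `φ` once. -/
theorem multiDeriv_comp_hin {φ : ℂ → ℂ} {ρ : ℝ} (hφ : AnalyticOnNhd ℂ φ (Metric.ball 0 ρ))
    (w : Fin n → ℂ) (q : Fin n → ℕ) {z : Fin n → ℂ} (hz : ‖hin z w‖ < ρ) :
    multiDeriv q (fun z => φ (hin z w)) z =
      conj (mono q w) * iteratedDeriv (∑ i, q i) φ (hin z w) := by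
  set U : Set (Fin n → ℂ) := {z | ‖hin z w‖ < ρ} with hU
  have hUo : IsOpen U := isOpen_norm_hin_lt w ρ
  have hd : ∀ N, DifferentiableOn ℂ (iteratedDeriv N φ) (Metric.ball 0 ρ) := fun N => by
    rw [iteratedDeriv_eq_iterate]
    exact (hφ.iterated_deriv N).differentiableOn
  have hit : ∀ (i : Fin n) (c : ℂ) (N j : ℕ),
      Set.EqOn ((pderiv i)^[j] fun z => c * iteratedDeriv N φ (hin z w))
        (fun z => conj (w i) ^ j * c * iteratedDeriv (j + N) φ (hin z w)) U := by
    intro i c N j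
    induction j with
    | zero => intro z _; simp
    | succ j ih =>
      intro z hz
      rw [Function.iterate_succ_apply', pderiv_eqOn hUo ih i hz, pderiv_const_mul_comp_hin
        ((hd _).differentiableAt (Metric.isOpen_ball.mem_nhds (by simpa [hU] using hz))),
        ← iteratedDeriv_succ, pow_succ']
      simp only [Nat.add_right_comm j 1 N, mul_assoc]
  have hl : ∀ l : List (Fin n), Set.EqOn
      (l.foldr (fun i g => (pderiv i)^[q i] g) fun z => φ (hin z w))
      (fun z => (l.map fun i => conj (w i) ^ q i).prod *
        iteratedDeriv (l.map q).sum φ (hin z w)) U := by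
    intro l
    induction l with
    | nil => intro z _; simp
    | cons i l ih =>
      intro z hz
      rw [List.foldr_cons, iterate_pderiv_eqOn hUo ih i (q i) hz, hit i _ _ _ hz]
      simp
  rw [multiDeriv, hl _ hz, ← List.ofFn_eq_map, ← List.ofFn_eq_map, List.prod_ofFn, List.sum_ofFn]
  simp [mono]

theorem analyticOnNhd_comp_hin {φ : ℂ → ℂ} {ρ : ℝ} (hφ : AnalyticOnNhd ℂ φ (Metric.ball 0 ρ))
    (w : Fin n → ℂ) : AnalyticOnNhd ℂ (fun z => φ (hin z w)) {z | ‖hin z w‖ < ρ} := fun z hz =>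
  AnalyticAt.comp (f := fun z => hin z w) (hφ (hin z w) (by simpa using hz)) (analyticAt_hin z w)

theorem homPart_comp_hin {φ : ℂ → ℂ} {ρ : ℝ} (hρ : 0 < ρ)
    (hφ : AnalyticOnNhd ℂ φ (Metric.ball 0 ρ)) (w z : Fin n → ℂ) (k : ℕ) :
    homPart k (fun z => φ (hin z w)) z = iteratedDeriv k φ 0 / k.factorial * hin z w ^ k := by
  have h0 : ‖hin (0 : Fin n → ℂ) w‖ < ρ := by simpa [hin] using hρ
  rw [homPart, iteratedDeriv_line (isOpen_norm_hin_lt w ρ) (analyticOnNhd_comp_hin hφ w) z k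
    (t := 0) (by simpa using h0), hin_pow, Finset.mul_sum, Finset.sum_div]
  refine Finset.sum_congr rfl fun q hq => ?_
  rw [zero_smul, multiDeriv_comp_hin hφ w q h0, (Finset.mem_piAntidiag.mp hq).1]
  have : hin (0 : Fin n → ℂ) w = 0 := by simp [hin]
  rw [this, mono, mono]
  ring

/-! ### The reproducing kernel of a radial weight -/

/-- The Taylor coefficients of the reproducing kernel of order `m` as a function of `⟨z, w⟩`, in
terms of the moments of the weight. -/
def kernelCoeff (m : ℕ) (M : ℕ → ℝ) (k : ℕ) : ℝ :=
  if k < m then (M k)⁻¹ else ((k.descFactorial m : ℝ) ^ 2 * M (k - m))⁻¹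

/-- The reproducing kernel of order `m` of the weight `μ`. -/
def kernel (μ : Measure (Fin n → ℂ)) (i : Fin n) (m : ℕ) (z w : Fin n → ℂ) : ℂ :=
  powSeries (fun k => (kernelCoeff m (moment μ i) k : ℂ)) (hin z w)

theorem conj_kernel (μ : Measure (Fin n → ℂ)) (i : Fin n) (m : ℕ) (z w : Fin n → ℂ) :
    conj (kernel μ i m z w) = kernel μ i m w z := by
  simp only [kernel, powSeries, Complex.conj_tsum, map_mul, map_pow, conj_hin, Complex.conj_ofReal]

/-- The hypothesis gives `ρ^k / M_k ≤ 1/δ`. Above degree `m` the index shift costs a factor `ρ^m`,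
while the falling factorial is at least `1`; the constant `1 + ρ^m` covers both ranges. -/
theorem exists_kernelCoeff_bound {M : ℕ → ℝ} {δ ρ : ℝ} (hδ : 0 < δ) (hρ : 0 < ρ)
    (hM : ∀ k, δ * ρ ^ k ≤ M k) (m : ℕ) (k : ℕ) :
    |kernelCoeff m M k| * ρ ^ k ≤ (1 + ρ ^ m) / δ := by
  have hMp : ∀ k, 0 < M k := fun k => lt_of_lt_of_le (by positivity) (hM k)
  have hinv : ∀ k, (M k)⁻¹ * ρ ^ k ≤ δ⁻¹ := fun k => by
    rw [inv_mul_le_iff₀ (hMp k)]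
    calc ρ ^ k = δ * ρ ^ k * δ⁻¹ := by field_simp
      _ ≤ M k * δ⁻¹ := mul_le_mul_of_nonneg_right (hM k) (by positivity)
  unfold kernelCoeff
  split_ifs with hk
  · rw [abs_of_pos (inv_pos.mpr (hMp k)), div_eq_mul_inv]
    calc (M k)⁻¹ * ρ ^ k ≤ δ⁻¹ := hinv k
      _ ≤ (1 + ρ ^ m) * δ⁻¹ := le_mul_of_one_le_left (by positivity)
          (by linarith [pow_pos hρ m])
  · push Not at hk
    have hd : (1 : ℝ) ≤ (k.descFactorial m : ℝ) ^ 2 := by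
      have : 1 ≤ k.descFactorial m := Nat.pos_of_ne_zero fun h0 =>
        absurd (Nat.descFactorial_eq_zero_iff_lt.mp h0) (not_lt.mpr hk)
      exact one_le_pow₀ (by exact_mod_cast this)
    have hMk := hMp (k - m)
    rw [abs_of_pos (by positivity), mul_inv, div_eq_mul_inv]
    calc ((k.descFactorial m : ℝ) ^ 2)⁻¹ * (M (k - m))⁻¹ * ρ ^ k
        ≤ 1 * (M (k - m))⁻¹ * ρ ^ k := by
          gcongr
          exact inv_le_one_of_one_le₀ hd
      _ = ρ ^ m * ((M (k - m))⁻¹ * ρ ^ (k - m)) := by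
          rw [one_mul, mul_left_comm, ← pow_add, Nat.add_sub_cancel' hk]
      _ ≤ ρ ^ m * δ⁻¹ := mul_le_mul_of_nonneg_left (hinv _) (by positivity)
      _ ≤ (1 + ρ ^ m) * δ⁻¹ := by gcongr; linarith

namespace IsRadialWeight

variable {Ω : Set (Fin n → ℂ)} {μ : Measure (Fin n → ℂ)}

/-- Markov's inequality, with `δ` the mass of the set where `|z_i|² ≥ ρ`. It makes the kernel series
converge for `|x| < ρ`. -/
theorem exists_le_moment (h : IsRadialWeight Ω μ) (i : Fin n) {ρ : ℝ} (hρ : 0 ≤ ρ)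
    (hm : μ {z | ρ ≤ ‖z i‖ ^ 2} ≠ 0) : ∃ δ : ℝ, 0 < δ ∧ ∀ k, δ * ρ ^ k ≤ moment μ i k := by
  have hfin : μ {z | ρ ≤ ‖z i‖ ^ 2} ≠ ∞ := by
    have h1 := h.lintegral_ne_top i 0
    simp only [mul_zero, pow_zero, lintegral_const, one_mul] at h1
    exact ne_top_of_le_ne_top h1 (measure_mono (Set.subset_univ _))
  refine ⟨(μ {z | ρ ≤ ‖z i‖ ^ 2}).toReal, ENNReal.toReal_pos hm hfin, fun k => ?_⟩
  rw [moment_eq_toReal, ← ENNReal.toReal_ofReal (pow_nonneg hρ k), ← ENNReal.toReal_mul]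
  refine ENNReal.toReal_mono (h.lintegral_ne_top i k) ?_
  have hmeas : Measurable fun z : Fin n → ℂ => ‖z i‖ₑ ^ (2 * k) := by fun_prop
  rw [mul_comm]
  refine le_trans ?_ (mul_meas_ge_le_lintegral hmeas (ENNReal.ofReal (ρ ^ k)))
  refine mul_le_mul_right (measure_mono fun z hz => ?_) _
  have hz : ρ ≤ ‖z i‖ ^ 2 := hz
  rw [Set.mem_ofPred_eq, ← ofReal_norm, ← ENNReal.ofReal_pow (norm_nonneg _), pow_mul]
  exact ENNReal.ofReal_le_ofReal (by gcongr)

theorem exists_bound (h : IsRadialWeight Ω μ) (i : Fin n) {z w : Fin n → ℂ} (hz : z ∈ Ω)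
    (hw : w ∈ Ω) : ∃ ρ δ : ℝ, ‖hin z w‖ < ρ ∧ 0 < δ ∧ ∀ k, δ * ρ ^ k ≤ moment μ i k := by
  obtain ⟨ρ, hρ, hm⟩ := h.mass z hz w hw
  obtain ⟨δ, hδ, hM⟩ := h.exists_le_moment i ((norm_nonneg _).trans hρ.le) (hm i)
  exact ⟨ρ, δ, hρ, hδ, hM⟩

theorem moment_pos (h : IsRadialWeight Ω μ) (i : Fin n) {w : Fin n → ℂ} (hw : w ∈ Ω) (k : ℕ) :
    0 < moment μ i k := by
  obtain ⟨ρ, δ, hρ, hδ, hM⟩ := h.exists_bound i hw hw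
  have hρ0 : 0 < ρ := (norm_nonneg _).trans_lt hρ
  exact lt_of_lt_of_le (by positivity) (hM k)

theorem exists_kernelCoeff_bound (h : IsRadialWeight Ω μ) (i : Fin n) (m : ℕ) {z w : Fin n → ℂ}
    (hz : z ∈ Ω) (hw : w ∈ Ω) : ∃ ρ C : ℝ, ‖hin z w‖ < ρ ∧ 0 < ρ ∧
      ∀ k, ‖(kernelCoeff m (moment μ i) k : ℂ)‖ * ρ ^ k ≤ C := by
  obtain ⟨ρ, δ, hρ, hδ, hM⟩ := h.exists_bound i hz hw
  have hρ0 : 0 < ρ := (norm_nonneg _).trans_lt hρ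
  refine ⟨ρ, (1 + ρ ^ m) / δ, hρ, hρ0, fun k => ?_⟩
  rw [Complex.norm_real]
  exact BergmanDirichlet.exists_kernelCoeff_bound hδ hρ0 hM m k

theorem analyticOnNhd_kernel (h : IsRadialWeight Ω μ) (i : Fin n) (m : ℕ) {w : Fin n → ℂ}
    (hw : w ∈ Ω) : AnalyticOnNhd ℂ (fun z => kernel μ i m z w) Ω := fun z hz => by
  obtain ⟨ρ, C, hρ, hρ0, hb⟩ := h.exists_kernelCoeff_bound i m hz hw
  exact analyticOnNhd_comp_hin (analyticOnNhd_powSeries hρ0 hb) w z hρ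

theorem multiDeriv_kernel (h : IsRadialWeight Ω μ) (i : Fin n) (m : ℕ) {z w : Fin n → ℂ}
    (hz : z ∈ Ω) (hw : w ∈ Ω) (q : Fin n → ℕ) :
    multiDeriv q (fun z => kernel μ i m z w) z = conj (mono q w) *
      iteratedDeriv (∑ i, q i) (powSeries fun k => (kernelCoeff m (moment μ i) k : ℂ))
        (hin z w) := by
  obtain ⟨ρ, C, hρ, hρ0, hb⟩ := h.exists_kernelCoeff_bound i m hz hw
  exact multiDeriv_comp_hin (analyticOnNhd_powSeries hρ0 hb) w q hρ

theorem zero_mem (h : IsRadialWeight Ω μ) {w : Fin n → ℂ} (hw : w ∈ Ω) : 0 ∈ Ω := by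
  simpa using h.balanced w hw 0 (by simp)

theorem homPart_kernel (h : IsRadialWeight Ω μ) (i : Fin n) (m : ℕ) {w : Fin n → ℂ}
    (hw : w ∈ Ω) (z : Fin n → ℂ) (k : ℕ) : homPart k (fun z => kernel μ i m z w) z =
      kernelCoeff m (moment μ i) k * hin z w ^ k := by
  obtain ⟨ρ, C, hρ, hρ0, hb⟩ := h.exists_kernelCoeff_bound i m (h.zero_mem hw) hw
  refine (homPart_comp_hin hρ0 (analyticOnNhd_powSeries hρ0 hb) w z k).trans ?_
  have h5 : (k.factorial : ℂ) ≠ 0 := Nat.cast_ne_zero.mpr (Nat.factorial_ne_zero _)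
  rw [iteratedDeriv_powSeries_zero hρ0 hb]
  field_simp

/-! ### Expansion of the differentiated kernel in `L²(μ)` -/

/-- The Taylor coefficients of the `m`-th derivative of the kernel. -/
def derivCoeff (m : ℕ) (M : ℕ → ℝ) (j : ℕ) : ℝ := (((j + m).descFactorial m : ℝ) * M j)⁻¹

theorem descFactorial_ne_zero (m j : ℕ) : ((j + m).descFactorial m : ℝ) ≠ 0 :=
  Nat.cast_ne_zero.mpr fun h0 =>
    absurd (Nat.descFactorial_eq_zero_iff_lt.mp h0) (not_lt.mpr (Nat.le_add_left m j))

theorem descFactorial_mul_kernelCoeff (m : ℕ) (M : ℕ → ℝ) (j : ℕ) :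
    ((j + m).descFactorial m : ℝ) * kernelCoeff m M (j + m) = derivCoeff m M j := by
  have := descFactorial_ne_zero m j
  rw [kernelCoeff, if_neg (not_lt.mpr (Nat.le_add_left m j)), derivCoeff, Nat.add_sub_cancel,
    mul_inv, mul_inv]
  field_simp

theorem hasSum_iteratedDeriv_kernel (h : IsRadialWeight Ω μ) (i : Fin n) (m : ℕ)
    {z w : Fin n → ℂ} (hz : z ∈ Ω) (hw : w ∈ Ω) :
    HasSum (fun j => (derivCoeff m (moment μ i) j : ℂ) * hin z w ^ j)
      (iteratedDeriv m (powSeries fun k => (kernelCoeff m (moment μ i) k : ℂ)) (hin z w)) := by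
  obtain ⟨ρ, C, hρ, hρ0, hb⟩ := h.exists_kernelCoeff_bound i m hz hw
  convert! hasSum_iteratedDeriv_powSeries hρ0 hb m hρ using 2 with j
  rw [← descFactorial_mul_kernelCoeff]
  push_cast
  ring

/-- Expanding one factor into monomials in `z` and pairing each with the other factor gives `M_j ⟨w,
w⟩^j`. -/
theorem integral_norm_hin_pow (h : IsRadialWeight Ω μ) (i : Fin n) (w : Fin n → ℂ) (j : ℕ) :
    ∫ z, ‖hin z w ^ j‖ ^ 2 ∂μ = moment μ i j * hnormSq w ^ j := by
  have h1 : ∫ z, hin z w ^ j * conj (hin z w ^ j) ∂μ = moment μ i j * hin w w ^ j := by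
    have h2 : ∀ z, hin z w ^ j * conj (hin z w ^ j) =
        ∑ q ∈ Finset.piAntidiag (Finset.univ : Finset (Fin n)) j,
        ((Nat.multinomial Finset.univ q : ℂ) * conj (mono q w)) *
          (mono q z * conj (hin z w ^ j)) := fun z => by
      conv_lhs => rw [hin_pow z w j, Finset.sum_mul]
      rw [← hin_pow z w j]
      exact Finset.sum_congr rfl fun q _ => by ring
    simp only [h2]
    have hint : ∀ q, Integrable (fun z => ((Nat.multinomial Finset.univ q : ℂ) *
        conj (mono q w)) * (mono q z * conj (hin z w ^ j))) μ := fun q => Integrable.const_mul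
      ((h.memLp_mono i q).integrable_mul (h.memLp_hin_pow i w j).star) _
    rw [integral_finsetSum _ fun q _ => hint q, hin_pow, Finset.mul_sum]
    refine Finset.sum_congr rfl fun q hq => ?_
    rw [integral_const_mul]
    have := h.integral_mono_mul_conj_hin_pow i q w j
    rw [this, if_pos (Finset.mem_piAntidiag.mp hq).1]
    ring
  have h3 : ∀ z, hin z w ^ j * conj (hin z w ^ j) = ((‖hin z w ^ j‖ ^ 2 : ℝ) : ℂ) := fun z => by
    rw [Complex.mul_conj, Complex.normSq_eq_norm_sq]
  simp only [h3, integral_complex_ofReal, hin_self] at h1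
  exact_mod_cast h1

/-- These are the `L²(μ)` norms of the terms in the series of the differentiated kernel. Some `ρ >
|w|²` has `M_j ≥ δ ρ^j`, so the terms are at most `δ^{-1/2} y^j` with `y = (|w|²/ρ)^{1/2} < 1`. -/
theorem summable_norms (h : IsRadialWeight Ω μ) (i : Fin n) (m : ℕ) {w : Fin n → ℂ}
    (hw : w ∈ Ω) : Summable fun j =>
      derivCoeff m (moment μ i) j * Real.sqrt (moment μ i j * hnormSq w ^ j) := by
  obtain ⟨ρ, δ, hρ, hδ, hM⟩ := h.exists_bound i hw hw
  have hρ0 : 0 < ρ := (norm_nonneg _).trans_lt hρ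
  have hx0 := hnormSq_nonneg w
  rw [hin_self, Complex.norm_real, Real.norm_of_nonneg hx0] at hρ
  set y := Real.sqrt (hnormSq w / ρ) with hy
  have hy1 : y < 1 := by
    rw [hy, Real.sqrt_lt' one_pos, one_pow, div_lt_one hρ0]
    exact hρ
  have hy0 : 0 ≤ y := Real.sqrt_nonneg _
  refine Summable.of_nonneg_of_le (fun j => ?_) (fun j => ?_)
    ((summable_geometric_of_lt_one hy0 hy1).mul_left (Real.sqrt δ)⁻¹)
  · have := h.moment_pos i hw j
    unfold derivCoeff
    positivity
  · have hMj := h.moment_pos i hw j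
    have hd1 : derivCoeff m (moment μ i) j ≤ (moment μ i j)⁻¹ := by
      unfold derivCoeff
      have : (1 : ℝ) ≤ (j + m).descFactorial m := by
        exact_mod_cast Nat.pos_of_ne_zero (Nat.cast_ne_zero.mp (descFactorial_ne_zero m j))
      gcongr
      exact le_mul_of_one_le_left hMj.le this
    have hys : hnormSq w ^ j = (y ^ j) ^ 2 * ρ ^ j := by
      rw [← pow_mul, mul_comm j 2, pow_mul, hy, Real.sq_sqrt (by positivity), div_pow]
      field_simp
    calc derivCoeff m (moment μ i) j * Real.sqrt (moment μ i j * hnormSq w ^ j)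
        ≤ (moment μ i j)⁻¹ * Real.sqrt (moment μ i j * hnormSq w ^ j) := by gcongr
      _ = Real.sqrt ((moment μ i j)⁻¹ * hnormSq w ^ j) := by
          conv_lhs => rw [← Real.sqrt_sq (inv_pos.mpr hMj).le]
          rw [← Real.sqrt_mul (by positivity)]
          congr 1
          field_simp
      _ ≤ Real.sqrt (δ⁻¹ * (y ^ j) ^ 2) := by
          apply Real.sqrt_le_sqrt
          rw [hys, inv_mul_le_iff₀ hMj]
          calc (y ^ j) ^ 2 * ρ ^ j = δ * ρ ^ j * (δ⁻¹ * (y ^ j) ^ 2) := by field_simp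
            _ ≤ moment μ i j * (δ⁻¹ * (y ^ j) ^ 2) := by gcongr; exact hM j
      _ = (Real.sqrt δ)⁻¹ * y ^ j := by
          rw [Real.sqrt_mul (by positivity), Real.sqrt_inv, Real.sqrt_sq (by positivity)]

theorem sqrt_integral_rpow_two {f : (Fin n → ℂ) → ℝ} :
    (∫ z, f z ^ (2 : ℝ) ∂μ) ^ (1 / 2 : ℝ) = Real.sqrt (∫ z, f z ^ 2 ∂μ) := by
  simp only [Real.rpow_ofNat, Real.sqrt_eq_rpow]

theorem eLpNorm_term (h : IsRadialWeight Ω μ) (i : Fin n) (m : ℕ) {w : Fin n → ℂ} (hw : w ∈ Ω)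
    (j : ℕ) : eLpNorm (fun z => (derivCoeff m (moment μ i) j : ℂ) * hin z w ^ j) 2 μ =
      ENNReal.ofReal (derivCoeff m (moment μ i) j * Real.sqrt (moment μ i j * hnormSq w ^ j)) := by
  have hd : 0 ≤ derivCoeff m (moment μ i) j := by
    have := h.moment_pos i hw j
    unfold derivCoeff
    positivity
  have h1 : (fun z => (derivCoeff m (moment μ i) j : ℂ) * hin z w ^ j) =
      (derivCoeff m (moment μ i) j : ℂ) • fun z => hin z w ^ j := rfl
  rw [h1, eLpNorm_const_smul, MemLp.eLpNorm_eq_integral_rpow_norm (by simp) (by simp)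
    (h.memLp_hin_pow i w j), ENNReal.ofReal_mul hd, ← h.integral_norm_hin_pow i w j,
    ← sqrt_integral_rpow_two]
  congr 1
  · rw [← ofReal_norm, Complex.norm_real, Real.norm_of_nonneg hd]
  · simp

/-- Fatou's lemma: the norm of the pointwise limit is at most the lower limit of the norms of the
partial sums, and the triangle inequality bounds those by the sum in `summable_norms`. -/
theorem memLp_iteratedDeriv_kernel (h : IsRadialWeight Ω μ) (i : Fin n) (m : ℕ)
    {w : Fin n → ℂ} (hw : w ∈ Ω) :
    MemLp (fun z => iteratedDeriv m
      (powSeries fun k => (kernelCoeff m (moment μ i) k : ℂ)) (hin z w)) 2 μ := by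
  set d := derivCoeff m (moment μ i) with hd
  have hT : ∀ N, AEStronglyMeasurable (fun z => ∑ j ∈ Finset.range N, (d j : ℂ) * hin z w ^ j) μ :=
    fun N => Continuous.aestronglyMeasurable
      (continuous_finsetSum _ fun j _ => continuous_const.mul ((continuous_hin_left w).pow j))
  have hlim : ∀ᵐ z ∂μ, Tendsto (fun N => ∑ j ∈ Finset.range N, (d j : ℂ) * hin z w ^ j) atTop
      (𝓝 (iteratedDeriv m (powSeries fun k => (kernelCoeff m (moment μ i) k : ℂ)) (hin z w))) := by
    filter_upwards [h.ae_mem] with z hz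
    exact (h.hasSum_iteratedDeriv_kernel i m hz hw).tendsto_sum_nat
  have hs := h.summable_norms i m hw
  refine ⟨aestronglyMeasurable_of_tendsto_ae atTop hT hlim, ?_⟩
  refine lt_of_le_of_lt (Lp.eLpNorm_lim_le_liminf_eLpNorm hT _ hlim) ?_
  refine lt_of_le_of_lt (liminf_le_of_frequently_le' (Frequently.of_forall fun N => ?_))
    (ENNReal.ofReal_lt_top (r := ∑' j, d j * Real.sqrt (moment μ i j * hnormSq w ^ j)))
  have hnn : ∀ j, 0 ≤ d j * Real.sqrt (moment μ i j * hnormSq w ^ j) := fun j => by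
    have := h.moment_pos i hw j
    rw [hd]
    unfold derivCoeff
    positivity
  have h1 : (fun z => ∑ j ∈ Finset.range N, (d j : ℂ) * hin z w ^ j) =
      ∑ j ∈ Finset.range N, fun z => (d j : ℂ) * hin z w ^ j := by
    ext z; simp
  rw [h1]
  have hm : ∀ j ∈ Finset.range N, AEStronglyMeasurable (fun z => (d j : ℂ) * hin z w ^ j) μ :=
    fun j _ => Continuous.aestronglyMeasurable
      (continuous_const.mul ((continuous_hin_left w).pow j))
  refine (eLpNorm_sum_le hm (by norm_num)).trans ?_
  rw [Finset.sum_congr rfl fun j _ => h.eLpNorm_term i m hw j,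
    ← ENNReal.ofReal_sum_of_nonneg fun j _ => hnn j]
  exact ENNReal.ofReal_le_ofReal (hs.sum_le_tsum _ fun j _ => hnn j)

/-- By Cauchy–Schwarz the `j`-th term has `L¹` norm at most the norm of `g` times the `j`-th term of
`summable_norms`; so sum and integral may be exchanged, and `integral_mul_conj_hin_pow` evaluates
each term. -/
theorem hasSum_integral_mul_conj (h : IsRadialWeight Ω μ) (i : Fin n) (m : ℕ)
    {w : Fin n → ℂ} (hw : w ∈ Ω) {g : (Fin n → ℂ) → ℂ} (hg : AnalyticOnNhd ℂ g Ω)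
    (hg2 : MemLp g 2 μ) :
    HasSum (fun j => ((derivCoeff m (moment μ i) j * moment μ i j : ℝ) : ℂ) * homPart j g w)
      (∫ z, g z * conj (iteratedDeriv m
        (powSeries fun k => (kernelCoeff m (moment μ i) k : ℂ)) (hin z w)) ∂μ) := by
  set d := derivCoeff m (moment μ i) with hd
  have hd0 : ∀ j, 0 ≤ d j := fun j => by
    have := h.moment_pos i hw j
    rw [hd]
    unfold derivCoeff
    positivity
  have hint : ∀ j, Integrable (fun z => (d j : ℂ) * (g z * conj (hin z w ^ j))) μ := fun j =>
    Integrable.const_mul (hg2.integrable_mul (h.memLp_hin_pow i w j).star) _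
  have hbound : ∀ j, ∫ z, ‖(d j : ℂ) * (g z * conj (hin z w ^ j))‖ ∂μ ≤
      Real.sqrt (∫ z, ‖g z‖ ^ 2 ∂μ) * (d j * Real.sqrt (moment μ i j * hnormSq w ^ j)) := fun j => by
    have h1 := integral_mul_le_Lp_mul_Lq_of_nonneg (μ := μ) Real.HolderConjugate.two_two
      (f := fun z => ‖g z‖) (g := fun z => ‖hin z w ^ j‖) (ae_of_all _ fun z => norm_nonneg _)
      (ae_of_all _ fun z => norm_nonneg _) (by simpa using hg2.norm)
      (by simpa using (h.memLp_hin_pow i w j).norm)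
    rw [sqrt_integral_rpow_two, sqrt_integral_rpow_two, h.integral_norm_hin_pow i] at h1
    simp only [norm_mul, RCLike.norm_conj, Complex.norm_real, Real.norm_of_nonneg (hd0 j),
      integral_const_mul]
    calc d j * ∫ z, ‖g z‖ * ‖hin z w ^ j‖ ∂μ ≤ d j * _ := mul_le_mul_of_nonneg_left h1 (hd0 j)
      _ = _ := by ring
  have hsum := hasSum_integral_of_summable_integral_norm hint
    (Summable.of_nonneg_of_le (fun j => integral_nonneg fun z => norm_nonneg _) hbound
      ((h.summable_norms i m hw).mul_left _))
  have hterm : ∀ j, ∫ z, (d j : ℂ) * (g z * conj (hin z w ^ j)) ∂μ =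
      ((d j * moment μ i j : ℝ) : ℂ) * homPart j g w := fun j => by
    rw [integral_const_mul, h.integral_mul_conj_hin_pow (h.zero_mem hw) i hg hg2]
    push_cast
    ring
  simp only [hterm] at hsum
  convert! hsum using 1
  refine integral_congr_ae ?_
  filter_upwards [h.ae_mem] with z hz
  have h2 := (((h.hasSum_iteratedDeriv_kernel i m hz hw).map (starRingEnd ℂ)
    Complex.continuous_conj).mul_left (g z))
  rw [← h2.tsum_eq]
  refine tsum_congr fun j => ?_
  simp only [Function.comp_apply, map_mul, Complex.conj_ofReal, hd]
  ring

/-! ### The reproducing property -/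

theorem memLp_multiDeriv (h : IsRadialWeight Ω μ) {m : ℕ} {f : (Fin n → ℂ) → ℂ}
    (hf : f ∈ space Ω μ m) {q : Fin n → ℕ}
    (hq : q ∈ Finset.piAntidiag (Finset.univ : Finset (Fin n)) m) :
    MemLp (multiDeriv q f) 2 μ := by
  rw [memLp_two_iff (h.aestronglyMeasurable (analyticOnNhd_multiDeriv hf.1 q).continuousOn)]
  have h1 := (ENNReal.add_lt_top.mp hf.2).2
  have h2 := ENNReal.sum_lt_top.mp h1 q hq
  exact ENNReal.lt_top_of_mul_ne_top_right h2.ne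
    (Nat.cast_ne_zero.mpr (Nat.multinomial_pos _ _).ne')

theorem kernel_mem_space (h : IsRadialWeight Ω μ) (i : Fin n) (m : ℕ) {w : Fin n → ℂ}
    (hw : w ∈ Ω) : (fun z => kernel μ i m z w) ∈ space Ω μ m := by
  have ha := h.analyticOnNhd_kernel i m hw
  refine ⟨ha, ENNReal.add_lt_top.mpr ⟨?_, ENNReal.sum_lt_top.mpr fun q hq =>
    ENNReal.mul_lt_top (ENNReal.natCast_lt_top _) ?_⟩⟩
  · have h1 : lowPart m (fun z => kernel μ i m z w) =
        fun z => ∑ k ∈ Finset.range m, homPart k (fun z => kernel μ i m z w) z :=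
      funext fun z => lowPart_eq_sum h.isOpen (h.zero_mem hw) ha m z
    have h2 : MemLp (lowPart m fun z => kernel μ i m z w) 2 μ := by
      rw [h1]
      exact memLp_finsetSum _ fun k _ => h.memLp_homPart (h.zero_mem hw) i ha k
    exact (memLp_two_iff h2.1).mp h2
  · have h2 : MemLp (multiDeriv q fun z => kernel μ i m z w) 2 μ := by
      refine ((h.memLp_iteratedDeriv_kernel i m hw).const_mul (conj (mono q w))).ae_eq ?_
      filter_upwards [h.ae_mem] with z hz
      rw [h.multiDeriv_kernel i m hz hw q, (Finset.mem_piAntidiag.mp hq).1]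
    exact (memLp_two_iff h2.1).mp h2

/-- Distinct degrees are orthogonal, and in degree `k < m` the coefficient `1/M_k` cancels the
moment. -/
theorem integral_lowPart_mul_conj (h : IsRadialWeight Ω μ) (i : Fin n) (m : ℕ)
    {w : Fin n → ℂ} (hw : w ∈ Ω) {f : (Fin n → ℂ) → ℂ} (hf : AnalyticOnNhd ℂ f Ω) :
    ∫ z, lowPart m f z * conj (lowPart m (fun z => kernel μ i m z w) z) ∂μ =
      ∑ k ∈ Finset.range m, homPart k f w := by
  have h0 := h.zero_mem hw
  have hK := h.analyticOnNhd_kernel i m hw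
  have h1 : ∀ z, lowPart m f z * conj (lowPart m (fun z => kernel μ i m z w) z) =
      ∑ k ∈ Finset.range m, ∑ j ∈ Finset.range m, (kernelCoeff m (moment μ i) j : ℂ) *
        (homPart k f z * conj (hin z w ^ j)) := fun z => by
    rw [lowPart_eq_sum h.isOpen h0 hf, lowPart_eq_sum h.isOpen h0 hK, map_sum,
      Finset.sum_mul_sum]
    refine Finset.sum_congr rfl fun k _ => Finset.sum_congr rfl fun j _ => ?_
    rw [h.homPart_kernel i m hw, map_mul, Complex.conj_ofReal]
    ring
  have hint : ∀ k j, Integrable (fun z => (kernelCoeff m (moment μ i) j : ℂ) *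
      (homPart k f z * conj (hin z w ^ j))) μ := fun k j =>
    Integrable.const_mul ((h.memLp_homPart h0 i hf k).integrable_mul
      (h.memLp_hin_pow i w j).star) _
  simp only [h1]
  rw [integral_finsetSum _ fun k _ => integrable_finsetSum _ fun j _ => hint k j]
  refine Finset.sum_congr rfl fun k hk => ?_
  rw [integral_finsetSum _ fun j _ => hint k j]
  simp only [integral_const_mul, h.integral_homPart_mul_conj_hin_pow h0 i hf]
  rw [Finset.sum_eq_single k]
  · have hM : (moment μ i k : ℂ) ≠ 0 := by exact_mod_cast (h.moment_pos i hw k).ne'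
    rw [if_pos rfl, kernelCoeff, if_pos (Finset.mem_range.mp hk)]
    push_cast
    field_simp
  · intro j _ hj
    rw [if_neg (Ne.symm hj), mul_zero]
  · exact fun hk' => absurd hk hk'

theorem multinomial_mul_integral (h : IsRadialWeight Ω μ) (i : Fin n) (m : ℕ) {w : Fin n → ℂ}
    (hw : w ∈ Ω) (f : (Fin n → ℂ) → ℂ) {q : Fin n → ℕ}
    (hq : q ∈ Finset.piAntidiag (Finset.univ : Finset (Fin n)) m) :
    (Nat.multinomial Finset.univ q : ℂ) *
      ∫ z, multiDeriv q f z * conj (multiDeriv q (fun z => kernel μ i m z w) z) ∂μ =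
    ((Nat.multinomial Finset.univ q : ℂ) * mono q w) *
      ∫ z, multiDeriv q f z * conj (iteratedDeriv m
        (powSeries fun k => (kernelCoeff m (moment μ i) k : ℂ)) (hin z w)) ∂μ := by
  rw [mul_assoc, ← integral_const_mul (mono q w)]
  congr 1
  refine integral_congr_ae ?_
  filter_upwards [h.ae_mem] with z hz
  rw [h.multiDeriv_kernel i m hz hw q, (Finset.mem_piAntidiag.mp hq).1, map_mul,
    Complex.conj_conj]
  ring

/-- The product of `derivCoeff` and the moment is the inverse of the falling factorial produced by
`sum_homPart_multiDeriv`. -/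
theorem sum_derivCoeff_mul_homPart (h : IsRadialWeight Ω μ) (i : Fin n) (m : ℕ) {w : Fin n → ℂ}
    (hw : w ∈ Ω) {f : (Fin n → ℂ) → ℂ} (hf : AnalyticOnNhd ℂ f Ω) (j : ℕ) :
    ∑ q ∈ Finset.piAntidiag (Finset.univ : Finset (Fin n)) m,
      (Nat.multinomial Finset.univ q : ℂ) * mono q w *
        (((derivCoeff m (moment μ i) j * moment μ i j : ℝ) : ℂ) * homPart j (multiDeriv q f) w) =
      homPart (j + m) f w := by
  have h2 := sum_homPart_multiDeriv h.isOpen (h.zero_mem hw) hf m j w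
  have h3 : ((derivCoeff m (moment μ i) j * moment μ i j : ℝ) : ℂ) =
      ((j + m).descFactorial m : ℂ)⁻¹ := by
    have hM := (h.moment_pos i hw j).ne'
    rw [derivCoeff, mul_inv, mul_assoc, inv_mul_cancel₀ hM, mul_one, Complex.ofReal_inv,
      Complex.ofReal_natCast]
  have h4 : ((j + m).descFactorial m : ℂ) ≠ 0 :=
    Nat.cast_ne_zero.mpr (Nat.cast_ne_zero.mp (descFactorial_ne_zero m j))
  rw [h3]
  calc _ = ((j + m).descFactorial m : ℂ)⁻¹ *
        ∑ q ∈ Finset.piAntidiag (Finset.univ : Finset (Fin n)) m,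
          (Nat.multinomial Finset.univ q : ℂ) * (∏ i, w i ^ q i) * homPart j (multiDeriv q f) w := by
        rw [Finset.mul_sum]
        exact Finset.sum_congr rfl fun q _ => by rw [mono]; ring
    _ = homPart (j + m) f w := by rw [h2, inv_mul_cancel_left₀ h4]

theorem hasSum_homPart_add (h : IsRadialWeight Ω μ) (i : Fin n) (m : ℕ) {w : Fin n → ℂ}
    (hw : w ∈ Ω) {f : (Fin n → ℂ) → ℂ} (hf : f ∈ space Ω μ m) :
    HasSum (fun j => homPart (j + m) f w)
      (∑ q ∈ Finset.piAntidiag (Finset.univ : Finset (Fin n)) m,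
        (Nat.multinomial Finset.univ q : ℂ) *
        ∫ z, multiDeriv q f z * conj (multiDeriv q (fun z => kernel μ i m z w) z) ∂μ) := by
  rw [Finset.sum_congr rfl fun q hq => h.multinomial_mul_integral i m hw f hq]
  simp only [← h.sum_derivCoeff_mul_homPart i m hw hf.1]
  exact hasSum_sum fun q hq => (h.hasSum_integral_mul_conj i m hw
    (analyticOnNhd_multiDeriv hf.1 q) (h.memLp_multiDeriv hf hq)).mul_left _

/-- The value `f w` and the inner product are sums of the same series of homogeneous parts: the
low-order integral supplies the first `m` terms and the derivative integrals the tail. -/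
theorem isReproducingKernel (h : IsRadialWeight Ω μ) (i : Fin n) (m : ℕ) :
    IsReproducingKernel Ω μ m (kernel μ i m) := by
  refine ⟨fun w hw => h.kernel_mem_space i m hw, fun f hf w hw => ?_⟩
  have htot := (hasSum_nat_add_iff (f := fun k => homPart k f w) m).mp
    (h.hasSum_homPart_add i m hw hf)
  rw [innerProd, h.integral_lowPart_mul_conj i m hw hf.1, add_comm]
  exact (hasSum_homPart h.isOpen h.balanced hf.1 hw).unique htot

end IsRadialWeight

theorem conj_innerProd (μ : Measure (Fin n → ℂ)) (m : ℕ) (f g : (Fin n → ℂ) → ℂ) :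
    conj (innerProd μ m f g) = innerProd μ m g f := by
  simp only [innerProd, map_add, map_sum, map_mul, map_natCast, ← integral_conj,
    Complex.conj_conj, mul_comm]

/-- A reproducing kernel is unique, and it is Hermitian. -/
theorem IsReproducingKernel.eq_conj {Ω : Set (Fin n → ℂ)} {μ : Measure (Fin n → ℂ)} {m : ℕ}
    {K L : (Fin n → ℂ) → (Fin n → ℂ) → ℂ} (hK : IsReproducingKernel Ω μ m K)
    (hL : IsReproducingKernel Ω μ m L) {z w : Fin n → ℂ} (hz : z ∈ Ω) (hw : w ∈ Ω) :
    K z w = conj (L w z) := by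
  rw [hK.reproducing _ (hL.mem_space z hz) w hw, conj_innerProd]
  exact hL.reproducing _ (hK.mem_space w hw) z hz

theorem IsRadialWeight.eq_kernel {Ω : Set (Fin n → ℂ)} {μ : Measure (Fin n → ℂ)}
    (h : IsRadialWeight Ω μ) (i : Fin n) {m : ℕ} {K : (Fin n → ℂ) → (Fin n → ℂ) → ℂ}
    (hK : IsReproducingKernel Ω μ m K) {z w : Fin n → ℂ} (hz : z ∈ Ω) (hw : w ∈ Ω) :
    K z w = kernel μ i m z w := by
  rw [hK.eq_conj (h.isReproducingKernel i m) hz hw, conj_kernel]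

/-! ### The Gaussian weight and the weights on balls -/

theorem norm_hin_le (z w : Fin n → ℂ) : ‖hin z w‖ ≤ (hnormSq z + hnormSq w) / 2 := by
  rw [hin, hnormSq, hnormSq, ← Finset.sum_add_distrib, Finset.sum_div]
  refine (norm_sum_le _ _).trans (Finset.sum_le_sum fun i _ => ?_)
  rw [norm_mul, RCLike.norm_conj]
  nlinarith [sq_nonneg (‖z i‖ - ‖w i‖)]

/-- The density of the weight on the ball of radius `R`, as a function of `|z|²`. -/
def ballWeight (ν R : ℝ) : ℝ → ℝ≥0∞ :=
  (Set.Iio (R ^ 2)).indicator fun s => ENNReal.ofReal ((1 - s / R ^ 2) ^ (ν * R ^ 2))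

/-- The density of the Gaussian weight, as a function of `|z|²`. -/
def gaussWeight (ν s : ℝ) : ℝ≥0∞ := ENNReal.ofReal (Real.exp (-ν * s))

theorem measurable_ballWeight (ν R : ℝ) : Measurable (ballWeight ν R) :=
  Measurable.indicator (by fun_prop) measurableSet_Iio

theorem hball_eq {R : ℝ} (hR : 0 < R) : hball n R = {z | hnormSq z < R ^ 2} := by
  ext z
  exact Real.sqrt_lt' hR

theorem ballMeasure_eq (ν : ℝ) {R : ℝ} (hR : 0 < R) : ballMeasure n R (ν * R ^ 2) =
    volume.withDensity fun z => ballWeight ν R (hnormSq z) := by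
  rw [ballMeasure, hball_eq hR, ← withDensity_indicator (measurableSet_hnormSq_lt _)]
  rfl

theorem gaussMeasure_eq (ν : ℝ) :
    gaussMeasure n ν = volume.withDensity fun z => gaussWeight ν (hnormSq z) := rfl

/-- Bernoulli's inequality with exponent `R'²/R² ≥ 1` gives `1 - s/R² ≤ (1 - s/R'²)^{R'²/R²}`; raise
it to the power `νR²`. For `s ≥ R²` the left side is zero. -/
theorem ballWeight_mono {ν : ℝ} (hν : 0 < ν) {R R' : ℝ} (hR : 0 < R) (hRR' : R ≤ R') (s : ℝ) :
    ballWeight ν R s ≤ ballWeight ν R' s := by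
  have hR2 : R ^ 2 ≤ R' ^ 2 := by gcongr
  have hR0 : 0 < R ^ 2 := by positivity
  have hR0' : 0 < R' ^ 2 := hR0.trans_le hR2
  unfold ballWeight
  by_cases h : s < R ^ 2
  · rw [Set.indicator_of_mem (Set.mem_Iio.mpr h),
      Set.indicator_of_mem (Set.mem_Iio.mpr (h.trans_le hR2))]
    apply ENNReal.ofReal_le_ofReal
    have h1 : 0 ≤ 1 - s / R ^ 2 := by
      rw [sub_nonneg, div_le_one hR0]; exact h.le
    have h2 : 0 ≤ 1 - s / R' ^ 2 := by
      rw [sub_nonneg, div_le_one hR0']; exact (h.trans_le hR2).le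
    have h3 := one_add_mul_self_le_rpow_one_add (s := -(s / R' ^ 2)) (by linarith)
      (p := R' ^ 2 / R ^ 2) ((one_le_div hR0).mpr hR2)
    have h4 : 1 + R' ^ 2 / R ^ 2 * -(s / R' ^ 2) = 1 - s / R ^ 2 := by
      have := hR0'.ne'
      rw [mul_neg, div_mul_div_comm, mul_comm (R' ^ 2) s, mul_div_mul_right _ _ this]
      ring
    rw [h4, ← sub_eq_add_neg] at h3
    calc (1 - s / R ^ 2) ^ (ν * R ^ 2)
        ≤ ((1 - s / R' ^ 2) ^ (R' ^ 2 / R ^ 2)) ^ (ν * R ^ 2) :=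
          Real.rpow_le_rpow h1 h3 (by positivity)
      _ = (1 - s / R' ^ 2) ^ (ν * R' ^ 2) := by
          rw [← Real.rpow_mul h2]
          congr 1
          field_simp
  · rw [Set.indicator_of_notMem (by simpa using h)]
    exact zero_le

theorem ballWeight_le_gaussWeight {ν : ℝ} (hν : 0 < ν) {R : ℝ} (hR : 0 < R) (s : ℝ) :
    ballWeight ν R s ≤ gaussWeight ν s := by
  have hR0 : 0 < R ^ 2 := by positivity
  unfold ballWeight gaussWeight
  refine Set.indicator_apply_le' (fun h => ENNReal.ofReal_le_ofReal ?_) fun _ => zero_le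
  have h1 : 0 ≤ 1 - s / R ^ 2 := by
    rw [sub_nonneg, div_le_one hR0]; exact (Set.mem_Iio.mp h).le
  calc (1 - s / R ^ 2) ^ (ν * R ^ 2) ≤ Real.exp (-(s / R ^ 2)) ^ (ν * R ^ 2) :=
        Real.rpow_le_rpow h1 (Real.one_sub_le_exp_neg _) (by positivity)
    _ = Real.exp (-ν * s) := by
        rw [← Real.exp_mul]
        congr 1
        field_simp

theorem tendsto_ballWeight (ν s : ℝ) :
    Tendsto (fun R => ballWeight ν R s) atTop (𝓝 (gaussWeight ν s)) := by
  have hsq : Tendsto (fun R : ℝ => R ^ 2) atTop atTop := tendsto_pow_atTop two_ne_zero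
  have h1 := (Real.tendsto_one_add_div_rpow_exp (-s)).comp hsq
  have h2 := (h1.rpow_const (p := ν) (Or.inl (Real.exp_pos _).ne'))
  have h3 : Real.exp (-s) ^ ν = Real.exp (-ν * s) := by
    rw [← Real.exp_mul]
    congr 1
    ring
  rw [h3] at h2
  refine (ENNReal.tendsto_ofReal h2).congr' ?_
  filter_upwards [hsq.eventually_gt_atTop s, eventually_gt_atTop 0] with R hR hR0
  have hR2 : 0 < R ^ 2 := by positivity
  rw [ballWeight, Set.indicator_of_mem (Set.mem_Iio.mpr hR)]
  simp only [Function.comp_apply]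
  have h4 : 0 ≤ 1 + -s / R ^ 2 := by
    rw [neg_div, ← sub_eq_add_neg, sub_nonneg, div_le_one hR2]; exact hR.le
  rw [← Real.rpow_mul h4, mul_comm, neg_div, ← sub_eq_add_neg]

theorem lintegral_gaussMeasure_ne_top {ν : ℝ} (hν : 0 < ν) (i : Fin n) (k : ℕ) :
    ∫⁻ z, ‖z i‖ₑ ^ (2 * k) ∂gaussMeasure n ν ≠ ∞ := by
  have hm : Measurable fun z : Fin n → ℂ => gaussWeight ν (hnormSq z) :=
    (measurable_gauss ν).comp measurable_hnormSq
  have h3 : ∀ z : Fin n → ℂ, monoSq (Pi.single i k) z = ‖z i‖ₑ ^ (2 * k) := fun z => by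
    rw [monoSq, Finset.prod_eq_single i]
    · simp
    · intro j _ hj
      simp [Pi.single_eq_of_ne hj]
    · simp
  have h4 := lintegral_monoSq_gauss (Pi.single i k) hν
  simp only [h3] at h4
  rw [gaussMeasure_eq, lintegral_withDensity_eq_lintegral_mul _ hm (by fun_prop)]
  simp only [Pi.mul_apply, mul_comm (gaussWeight _ _)]
  exact h4.symm ▸ ENNReal.ofReal_ne_top

theorem ballMeasure_le_gaussMeasure {ν : ℝ} (hν : 0 < ν) {R : ℝ} (hR : 0 < R) :
    ballMeasure n R (ν * R ^ 2) ≤ gaussMeasure n ν := by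
  rw [ballMeasure_eq ν hR, gaussMeasure_eq]
  exact withDensity_mono (ae_of_all _ fun z => ballWeight_le_gaussWeight hν hR _)

theorem isRadialWeight_gaussMeasure {ν : ℝ} (hν : 0 < ν) :
    IsRadialWeight Set.univ (gaussMeasure n ν) where
  isOpen := isOpen_univ
  balanced := fun _ _ _ _ => Set.mem_univ _
  exists_density := ⟨gaussWeight ν, measurable_gauss ν, rfl⟩
  null_compl := by simp
  lintegral_ne_top := lintegral_gaussMeasure_ne_top hν
  mass := fun z _ w _ => by
    refine ⟨‖hin z w‖ + 1, lt_add_one _, fun i h => ?_⟩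
    have hac : (volume : Measure (Fin n → ℂ)) ≪ gaussMeasure n ν := by
      refine withDensity_absolutelyContinuous'
        ((measurable_gauss ν).comp measurable_hnormSq).aemeasurable (ae_of_all _ fun z => ?_)
      simp [Real.exp_pos]
    have h1 := hac h
    set ρ := ‖hin z w‖ + 1 with hρ
    have hρ0 : 0 < ρ := by positivity
    have hopen : IsOpen {z : Fin n → ℂ | ρ < ‖z i‖ ^ 2} :=
      isOpen_lt continuous_const (by fun_prop)
    have hne : {z : Fin n → ℂ | ρ < ‖z i‖ ^ 2}.Nonempty := by
      refine ⟨fun _ => ((ρ + 1 : ℝ) : ℂ), ?_⟩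
      change ρ < ‖((ρ + 1 : ℝ) : ℂ)‖ ^ 2
      rw [Complex.norm_real, Real.norm_of_nonneg (by positivity)]
      nlinarith
    refine (hopen.measure_pos volume hne).ne' (measure_mono_null (fun z hz => ?_) h1)
    exact (show ρ < ‖z i‖ ^ 2 from hz).le

/-- The density is positive on the ball, so it is enough that a nonempty open part of the ball lies
in the set. The witness is `√t` times the `i`-th basis vector, with `ρ < t < R²`. -/
theorem ballMeasure_ne_zero (ν : ℝ) {R : ℝ} (hR : 0 < R) {ρ : ℝ} (hρ0 : 0 ≤ ρ) (hρ : ρ < R ^ 2)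
    (i : Fin n) : ballMeasure n R (ν * R ^ 2) {z | ρ ≤ ‖z i‖ ^ 2} ≠ 0 := fun h => by
  have hms : MeasurableSet {z : Fin n → ℂ | hnormSq z < R ^ 2} := measurableSet_hnormSq_lt _
  have hac : volume.restrict {z : Fin n → ℂ | hnormSq z < R ^ 2} ≪
      ballMeasure n R (ν * R ^ 2) := by
    rw [ballMeasure, hball_eq hR]
    have := measurable_hnormSq (n := n)
    refine withDensity_absolutelyContinuous' (by fun_prop) ?_
    filter_upwards [ae_restrict_mem hms] with z hz
    have hz : hnormSq z < R ^ 2 := hz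
    rw [ne_eq, ENNReal.ofReal_eq_zero, not_le]
    refine Real.rpow_pos_of_pos ?_ _
    rw [sub_pos, div_lt_one (by positivity)]
    exact hz
  have h1 := hac h
  rw [Measure.restrict_apply' hms] at h1
  have hopen : IsOpen ({z : Fin n → ℂ | ρ < ‖z i‖ ^ 2} ∩ {z | hnormSq z < R ^ 2}) :=
    (isOpen_lt continuous_const (by fun_prop)).inter
      (isOpen_lt continuous_hnormSq continuous_const)
  obtain ⟨t, ht1, ht2⟩ := exists_between hρ
  have ht0 : 0 ≤ t := hρ0.trans ht1.le
  have hne : ({z : Fin n → ℂ | ρ < ‖z i‖ ^ 2} ∩ {z | hnormSq z < R ^ 2}).Nonempty := by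
    have hn : ‖((Real.sqrt t : ℝ) : ℂ)‖ ^ 2 = t := by
      rw [Complex.norm_real, Real.norm_of_nonneg (Real.sqrt_nonneg _), Real.sq_sqrt ht0]
    refine ⟨Pi.single i ((Real.sqrt t : ℝ) : ℂ), ?_, ?_⟩
    · change ρ < ‖(Pi.single i ((Real.sqrt t : ℝ) : ℂ) : Fin n → ℂ) i‖ ^ 2
      rwa [Pi.single_eq_same, hn]
    · change hnormSq (Pi.single i ((Real.sqrt t : ℝ) : ℂ)) < R ^ 2
      rw [hnormSq, Finset.sum_eq_single i]
      · rwa [Pi.single_eq_same, hn]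
      · intro j _ hj
        simp [Pi.single_eq_of_ne hj]
      · simp
  refine (hopen.measure_pos volume hne).ne' (measure_mono_null (fun z hz => ?_) h1)
  exact ⟨(show ρ < ‖z i‖ ^ 2 from hz.1).le, hz.2⟩

theorem isRadialWeight_ballMeasure {ν : ℝ} (hν : 0 < ν) {R : ℝ} (hR : 0 < R) :
    IsRadialWeight (hball n R) (ballMeasure n R (ν * R ^ 2)) where
  isOpen := by
    rw [hball_eq hR]
    exact isOpen_lt continuous_hnormSq continuous_const
  balanced := fun z hz t ht => by
    rw [hball_eq hR] at hz ⊢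
    have h1 : hnormSq z < R ^ 2 := hz
    have h2 : ‖t‖ ^ 2 ≤ 1 := pow_le_one₀ (norm_nonneg _) ht
    change hnormSq (t • z) < R ^ 2
    rw [hnormSq_smul]
    nlinarith [hnormSq_nonneg z]
  exists_density := ⟨ballWeight ν R, measurable_ballWeight ν R, ballMeasure_eq ν hR⟩
  null_compl := by
    refine withDensity_absolutelyContinuous _ _ ?_
    have hms : MeasurableSet (hball n R) := hball_eq (n := n) hR ▸ measurableSet_hnormSq_lt _
    rw [Measure.restrict_apply' hms]
    simp
  lintegral_ne_top := fun i k => ne_top_of_le_ne_top (lintegral_gaussMeasure_ne_top hν i k)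
    (lintegral_mono' (ballMeasure_le_gaussMeasure hν hR) le_rfl)
  mass := fun z hz w hw => by
    rw [hball_eq hR] at hz hw
    have h1 : hnormSq z < R ^ 2 := hz
    have h2 : hnormSq w < R ^ 2 := hw
    obtain ⟨ρ, hρ1, hρ2⟩ := exists_between (show ‖hin z w‖ < R ^ 2 from
      (norm_hin_le z w).trans_lt (by linarith))
    exact ⟨ρ, hρ1, ballMeasure_ne_zero ν hR ((norm_nonneg _).trans hρ1.le) hρ2⟩

/-! ### Convergence of the kernels -/

theorem lintegral_ballMeasure (ν : ℝ) {R : ℝ} (hR : 0 < R) (i : Fin n) (k : ℕ) :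
    ∫⁻ z, ‖z i‖ₑ ^ (2 * k) ∂ballMeasure n R (ν * R ^ 2) =
      ∫⁻ z : Fin n → ℂ, ballWeight ν R (hnormSq z) * ‖z i‖ₑ ^ (2 * k) := by
  rw [ballMeasure_eq ν hR]
  exact lintegral_withDensity_eq_lintegral_mul _
    ((measurable_ballWeight ν R).comp measurable_hnormSq) (by fun_prop)

theorem lintegral_gaussMeasure (ν : ℝ) (i : Fin n) (k : ℕ) :
    ∫⁻ z, ‖z i‖ₑ ^ (2 * k) ∂gaussMeasure n ν =
      ∫⁻ z : Fin n → ℂ, gaussWeight ν (hnormSq z) * ‖z i‖ₑ ^ (2 * k) := by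
  rw [gaussMeasure_eq]
  exact lintegral_withDensity_eq_lintegral_mul _
    ((measurable_gauss ν).comp measurable_hnormSq) (by fun_prop)

theorem moment_ballMeasure_mono {ν : ℝ} (hν : 0 < ν) {R R' : ℝ} (hR : 0 < R) (hRR' : R ≤ R')
    (i : Fin n) (k : ℕ) : moment (ballMeasure n R (ν * R ^ 2)) i k ≤
      moment (ballMeasure n R' (ν * R' ^ 2)) i k := by
  have hR' := hR.trans_le hRR'
  rw [IsRadialWeight.moment_eq_toReal, IsRadialWeight.moment_eq_toReal]
  refine ENNReal.toReal_mono ((isRadialWeight_ballMeasure hν hR').lintegral_ne_top i k) ?_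
  rw [lintegral_ballMeasure ν hR, lintegral_ballMeasure ν hR']
  exact lintegral_mono fun z =>
    mul_le_mul_left (ballWeight_mono hν hR hRR' (hnormSq z)) _

/-- Dominated convergence, the Gaussian density being the majorant. -/
theorem tendsto_moment_ballMeasure {ν : ℝ} (hν : 0 < ν) (i : Fin n) (k : ℕ) :
    Tendsto (fun R => moment (ballMeasure n R (ν * R ^ 2)) i k) atTop
      (𝓝 (moment (gaussMeasure n ν) i k)) := by
  simp only [IsRadialWeight.moment_eq_toReal]
  refine (ENNReal.tendsto_toReal (lintegral_gaussMeasure_ne_top hν i k)).comp ?_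
  have hfin := lintegral_gaussMeasure_ne_top hν i k
  rw [lintegral_gaussMeasure] at hfin ⊢
  have h1 : Tendsto (fun R => ∫⁻ z : Fin n → ℂ, ballWeight ν R (hnormSq z) * ‖z i‖ₑ ^ (2 * k))
      atTop (𝓝 (∫⁻ z : Fin n → ℂ, gaussWeight ν (hnormSq z) * ‖z i‖ₑ ^ (2 * k))) := by
    refine tendsto_lintegral_filter_of_dominated_convergence
      (fun z : Fin n → ℂ => gaussWeight ν (hnormSq z) * ‖z i‖ₑ ^ (2 * k))
      (Eventually.of_forall fun R => ?_) ?_ hfin (ae_of_all _ fun z => ?_)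
    · exact ((measurable_ballWeight ν R).comp measurable_hnormSq).mul (by fun_prop)
    · filter_upwards [eventually_gt_atTop 0] with R hR
      exact ae_of_all _ fun z => mul_le_mul_left (ballWeight_le_gaussWeight hν hR _) _
    · exact ENNReal.Tendsto.mul_const (tendsto_ballWeight ν _)
        (Or.inr (ENNReal.pow_ne_top enorm_ne_top))
  refine h1.congr' ?_
  filter_upwards [eventually_gt_atTop 0] with R hR
  exact (lintegral_ballMeasure ν hR i k).symm

theorem abs_kernelCoeff_le {M M' : ℕ → ℝ} (hM : ∀ k, 0 < M k) (hMM' : ∀ k, M k ≤ M' k)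
    (m k : ℕ) : |kernelCoeff m M' k| ≤ kernelCoeff m M k := by
  have hM' : ∀ k, 0 < M' k := fun k => (hM k).trans_le (hMM' k)
  unfold kernelCoeff
  split_ifs with hk
  · rw [abs_of_pos (inv_pos.mpr (hM' k))]
    exact inv_anti₀ (hM k) (hMM' k)
  · have hd : (0 : ℝ) < k.descFactorial m := Nat.cast_pos.mpr (Nat.pos_of_ne_zero fun h0 =>
      hk (Nat.descFactorial_eq_zero_iff_lt.mp h0))
    have h1 := hM (k - m)
    have h2 := hM' (k - m)
    rw [abs_of_pos (by positivity)]
    exact inv_anti₀ (by positivity) (by gcongr; exact hMM' _)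

theorem tendsto_kernelCoeff {M : ℝ → ℕ → ℝ} {M' : ℕ → ℝ} (hM' : ∀ k, M' k ≠ 0)
    (h : ∀ k, Tendsto (fun R => M R k) atTop (𝓝 (M' k))) (m k : ℕ) :
    Tendsto (fun R => kernelCoeff m (M R) k) atTop (𝓝 (kernelCoeff m M' k)) := by
  unfold kernelCoeff
  split_ifs with hk
  · exact (h k).inv₀ (hM' k)
  · have hd : (k.descFactorial m : ℝ) ≠ 0 := Nat.cast_ne_zero.mpr fun h0 =>
      hk (Nat.descFactorial_eq_zero_iff_lt.mp h0)
    exact ((h (k - m)).const_mul _).inv₀ (mul_ne_zero (pow_ne_zero 2 hd) (hM' _))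

/-- For `|x| ≤ B` the difference is at most `∑ |b_k(R) - c_k| B^k`, independently of `x`. This tends
to `0` by dominated convergence with majorant `2 β_k B^k`. -/
theorem tendstoUniformlyOn_powSeries {b : ℝ → ℕ → ℝ} {c β : ℕ → ℝ} {B : ℝ}
    (hβ : Summable fun k => β k * B ^ k) (hB : 0 ≤ B)
    (hb : ∀ᶠ R in atTop, ∀ k, |b R k| ≤ β k)
    (hlim : ∀ k, Tendsto (fun R => b R k) atTop (𝓝 (c k))) :
    TendstoUniformlyOn (fun R x => powSeries (fun k => (b R k : ℂ)) x)
      (powSeries fun k => (c k : ℂ)) atTop {x | ‖x‖ ≤ B} := by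
  have hc : ∀ k, |c k| ≤ β k := fun k =>
    le_of_tendsto (hlim k).abs (hb.mono fun R hR => hR k)
  have hsumm : ∀ {a : ℕ → ℝ}, (∀ k, |a k| ≤ β k) → ∀ {x : ℂ}, ‖x‖ ≤ B →
      Summable fun k => (a k : ℂ) * x ^ k := fun {a} ha {x} hx => by
    refine Summable.of_norm_bounded hβ fun k => ?_
    rw [norm_mul, Complex.norm_real, norm_pow]
    exact mul_le_mul (ha k) (by gcongr) (by positivity) ((abs_nonneg _).trans (ha k))
  have hdiff : ∀ {R k}, (∀ k, |b R k| ≤ β k) → ‖|b R k - c k| * B ^ k‖ ≤ 2 * (β k * B ^ k) :=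
    fun {R k} hR => by
    rw [Real.norm_of_nonneg (by positivity), ← mul_assoc]
    gcongr
    calc |b R k - c k| ≤ |b R k| + |c k| := abs_sub _ _
      _ ≤ 2 * β k := by linarith [hR k, hc k]
  have h0 : Tendsto (fun R => ∑' k, |b R k - c k| * B ^ k) atTop (𝓝 0) := by
    have := tendsto_tsum_of_dominated_convergence (f := fun R k => |b R k - c k| * B ^ k)
      (g := fun _ => (0 : ℝ)) (𝓕 := atTop) (hβ.mul_left 2) (fun k => by
        simpa using ((hlim k).sub_const (c k)).abs.mul_const (B ^ k))
      (hb.mono fun R hR k => hdiff hR)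
    simpa using this
  rw [Metric.tendstoUniformlyOn_iff]
  intro ε hε
  filter_upwards [h0.eventually_lt_const hε, hb] with R hRε hR x hx
  have hx : ‖x‖ ≤ B := hx
  have hs : Summable fun k => |b R k - c k| * B ^ k :=
    Summable.of_norm_bounded (hβ.mul_left 2) fun k => hdiff hR
  refine lt_of_le_of_lt ?_ hRε
  rw [dist_comm, dist_eq_norm, powSeries, powSeries,
    ← (hsumm hR hx).tsum_sub (hsumm hc hx)]
  refine tsum_of_norm_bounded hs.hasSum fun k => ?_
  rw [← sub_mul, norm_mul, norm_pow, ← Complex.ofReal_sub, Complex.norm_real]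
  exact mul_le_mul_of_nonneg_left (by gcongr) (abs_nonneg _)

theorem tendstoUniformlyOn_kernel {ν : ℝ} (hν : 0 < ν) (i : Fin n) (m : ℕ)
    {C : Set ((Fin n → ℂ) × (Fin n → ℂ))} {B : ℝ} (hB : 0 ≤ B)
    (hC : ∀ x ∈ C, ‖hin x.1 x.2‖ ≤ B) :
    TendstoUniformlyOn (fun (R : ℝ) (x : (Fin n → ℂ) × (Fin n → ℂ)) =>
        kernel (ballMeasure n R (ν * R ^ 2)) i m x.1 x.2)
      (fun x => kernel (gaussMeasure n ν) i m x.1 x.2) atTop C := by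
  -- Since `R₀² = B + 1`, there is room for `ρ` with `B < ρ < R₀²`. The coefficients at `R₀` are
  -- then `O(ρ^{-k})`, hence summable against `B^k`, and they dominate those for every `R ≥ R₀`.
  set R₀ := Real.sqrt (B + 1) with hR₀
  have hR₀0 : 0 < R₀ := Real.sqrt_pos.mpr (by linarith)
  have hR₀B : B < R₀ ^ 2 := by rw [Real.sq_sqrt (by linarith)]; linarith
  obtain ⟨ρ, hρ1, hρ2⟩ := exists_between hR₀B
  have hρ0 : 0 < ρ := hB.trans_lt hρ1
  have hw₀ := isRadialWeight_ballMeasure (n := n) hν hR₀0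
  have h0 : (0 : Fin n → ℂ) ∈ hball n R₀ := by
    rw [hball_eq hR₀0]
    change hnormSq 0 < R₀ ^ 2
    have h00 : hnormSq (0 : Fin n → ℂ) = 0 := by simp [hnormSq]
    rw [h00]
    positivity
  obtain ⟨δ, hδ, hM⟩ := hw₀.exists_le_moment i hρ0.le
    (ballMeasure_ne_zero ν hR₀0 hρ0.le hρ2 i)
  set M₀ := moment (ballMeasure n R₀ (ν * R₀ ^ 2)) i with hM₀
  have hpos : ∀ k, 0 < M₀ k := fun k => hw₀.moment_pos i h0 k
  have hβ : Summable fun k => kernelCoeff m M₀ k * B ^ k := by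
    refine Summable.of_norm_bounded ((summable_geometric_of_lt_one (r := B / ρ) (by positivity)
      ((div_lt_one hρ0).mpr hρ1)).mul_left ((1 + ρ ^ m) / δ)) fun k => ?_
    have h1 := exists_kernelCoeff_bound hδ hρ0 hM m k
    rw [norm_mul, Real.norm_eq_abs, norm_pow, Real.norm_of_nonneg hB]
    calc |kernelCoeff m M₀ k| * B ^ k = |kernelCoeff m M₀ k| * ρ ^ k * (B / ρ) ^ k := by
          rw [div_pow]
          field_simp
      _ ≤ (1 + ρ ^ m) / δ * (B / ρ) ^ k := by gcongr
  have hgauss : ∀ k, moment (gaussMeasure n ν) i k ≠ 0 := fun k =>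
    ((isRadialWeight_gaussMeasure hν).moment_pos i (Set.mem_univ 0) k).ne'
  have h1 := tendstoUniformlyOn_powSeries hβ hB
    (b := fun R => kernelCoeff m (moment (ballMeasure n R (ν * R ^ 2)) i))
    (c := kernelCoeff m (moment (gaussMeasure n ν) i))
    ((eventually_ge_atTop R₀).mono fun R hR k =>
      abs_kernelCoeff_le hpos (moment_ballMeasure_mono hν hR₀0 hR i) m k)
    (tendsto_kernelCoeff hgauss (tendsto_moment_ballMeasure hν i) m)
  exact (h1.comp fun x : (Fin n → ℂ) × (Fin n → ℂ) => hin x.1 x.2).mono hC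

theorem tendstoUniformlyOn_of_isReproducingKernel {ν : ℝ} (hν : 0 < ν) (i : Fin n) (m : ℕ)
    {K : ℝ → (Fin n → ℂ) → (Fin n → ℂ) → ℂ} {L : (Fin n → ℂ) → (Fin n → ℂ) → ℂ}
    (hK : ∀ R : ℝ, 0 < R → IsBergmanDirichletKernel n R (ν * R ^ 2) m (K R))
    (hL : IsBargmannDirichletKernel n ν m L) {C : Set ((Fin n → ℂ) × (Fin n → ℂ))}
    (hC : IsCompact C) :
    TendstoUniformlyOn (fun (R : ℝ) (x : (Fin n → ℂ) × (Fin n → ℂ)) => K R x.1 x.2)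
      (fun x => L x.1 x.2) atTop C := by
  have hcont : Continuous fun x : (Fin n → ℂ) × (Fin n → ℂ) => hnormSq x.1 + hnormSq x.2 :=
    (continuous_hnormSq.comp continuous_fst).add (continuous_hnormSq.comp continuous_snd)
  obtain ⟨B, hB⟩ := hC.bddAbove_image hcont.continuousOn
  have hB' : ∀ x ∈ C, hnormSq x.1 + hnormSq x.2 ≤ max B 0 := fun x hx =>
    (hB (Set.mem_image_of_mem _ hx)).trans (le_max_left _ _)
  have h1 := tendstoUniformlyOn_kernel hν i m (le_max_right B 0) fun x hx =>
    (norm_hin_le x.1 x.2).trans (by linarith [hB' x hx, le_max_right B 0])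
  have h2 : ∀ x ∈ C, kernel (gaussMeasure n ν) i m x.1 x.2 = L x.1 x.2 := fun x _ =>
    ((isRadialWeight_gaussMeasure hν).eq_kernel i hL (Set.mem_univ _) (Set.mem_univ _)).symm
  refine (h1.congr ?_).congr_right h2
  have hsq : Tendsto (fun R : ℝ => R ^ 2) atTop atTop := tendsto_pow_atTop two_ne_zero
  -- `K R` is determined only on the ball; once `R²` exceeds the bound for `|z|² + |w|²` on `C`,
  -- both points lie in it.
  filter_upwards [eventually_gt_atTop 0, hsq.eventually_gt_atTop (max B 0)] with R hR hRB x hx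
  have hx1 := hnormSq_nonneg x.1
  have hx2 := hnormSq_nonneg x.2
  have hxB := hB' x hx
  have hm : ∀ z : Fin n → ℂ, hnormSq z < R ^ 2 → z ∈ hball n R := fun z hz => by
    rw [hball_eq hR]
    exact hz
  exact ((isRadialWeight_ballMeasure hν hR).eq_kernel i (hK R hR) (hm _ (by linarith))
    (hm _ (by linarith))).symm

end

end BergmanDirichlet

theorem theorem3 (n : ℕ) (hn : 1 ≤ n) (m : ℕ) (ν : ℝ) (hν : 0 < ν) :
    (∀ R : ℝ, 0 < R → ∃ K : (Fin n → ℂ) → (Fin n → ℂ) → ℂ,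
      BergmanDirichlet.IsBergmanDirichletKernel n R (ν * R ^ 2) m K) ∧
    (∃ K : (Fin n → ℂ) → (Fin n → ℂ) → ℂ,
      BergmanDirichlet.IsBargmannDirichletKernel n ν m K) ∧
    ∀ (K : ℝ → (Fin n → ℂ) → (Fin n → ℂ) → ℂ) (L : (Fin n → ℂ) → (Fin n → ℂ) → ℂ),
      (∀ R : ℝ, 0 < R → BergmanDirichlet.IsBergmanDirichletKernel n R (ν * R ^ 2) m (K R)) →
      BergmanDirichlet.IsBargmannDirichletKernel n ν m L →
      (∀ z w : Fin n → ℂ, Tendsto (fun R : ℝ => K R z w) atTop (𝓝 (L z w))) ∧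
      ∀ C : Set ((Fin n → ℂ) × (Fin n → ℂ)), IsCompact C →
        TendstoUniformlyOn (fun (R : ℝ) (x : (Fin n → ℂ) × (Fin n → ℂ)) => K R x.1 x.2)
          (fun x => L x.1 x.2) atTop C := by
  -- The assumption `1 ≤ n` supplies a coordinate, here the first, whose moments define the kernel.
  refine ⟨fun R hR => ⟨_, (BergmanDirichlet.isRadialWeight_ballMeasure hν hR).isReproducingKernel
    ⟨0, hn⟩ m⟩, ⟨_, (BergmanDirichlet.isRadialWeight_gaussMeasure hν).isReproducingKernel
    ⟨0, hn⟩ m⟩, fun K L hK hL => ?_⟩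
  have h : ∀ C : Set ((Fin n → ℂ) × (Fin n → ℂ)), IsCompact C →
      TendstoUniformlyOn (fun (R : ℝ) (x : (Fin n → ℂ) × (Fin n → ℂ)) => K R x.1 x.2)
        (fun x => L x.1 x.2) atTop C := fun C hC =>
    BergmanDirichlet.tendstoUniformlyOn_of_isReproducingKernel hν ⟨0, hn⟩ m hK hL hC
  exact ⟨fun z w => (h {(z, w)} isCompact_singleton).tendsto_at (Set.mem_singleton _), h⟩
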